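/- There is a planar, locally finite, connected graph $G$ which has a tree-decomposition into finite parts (that is, $G$ has tree-width $<\aleph_0$), but which admits no rooted tree-decomposition into finite parts that is tight, componental and strongly linked. In particular, for $\kappa=\aleph_0$ it is not true that every graph of tree-width $<\kappa$ admits a tight and componental rooted tree-decomposition of width $<\kappa$ (that is, into parts of size $<\kappa$) that is strongly linked. Here, for a tree-decomposition $(T,(V_t)_{t\in T})$ of $G$, the adhesion set of an edge $e=st$ of $T$ is $V_e=V_s\cap V_t$. The tree-decomposition is strongly linked if for every two nodes $s\neq t$ of $T$ there are $\min\{|V_e| : e\in E(sTt)\}$ pairwise disjoint $V_s$--$V_t$ paths in $G$, where $sTt$ is the path in $T$ between $s$ and $t$. If $T$ is rooted, then for an edge $e$ of $T$ let $T_e$ be the component of $T-e$ that does not contain the root, and let the part strictly above $e$ be the subgraph of $G$ induced on $\bigcup_{t\in T_e}V_t\setminus V_e$. The rooted tree-decomposition is componental if for every edge $e$ of $T$ the part strictly above $e$ is connected; it is tight if for every edge $e$ of $T$ the part strictly above $e$ has a component $C$ with $N_G(C)=V_e$. -/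

import Mathlib

universe u v

/-- `A` is an arc in the plane from `p` to `q`: the image of an injective continuous map
from the unit interval that sends `0` to `p` and `1` to `q`. -/
def IsPlaneArc (A : Set (ℝ × ℝ)) (p q : ℝ × ℝ) : Prop :=
  ∃ γ : unitInterval → ℝ × ℝ,
    Continuous γ ∧ Function.Injective γ ∧ γ 0 = p ∧ γ 1 = q ∧ Set.range γ = A

/-- A drawing of `G` in the plane: distinct vertices are distinct points, every edge is an arc
between its endvertices, and the interior of an edge contains no vertex and no point of any
other edge. -/
structure PlaneDrawing {V : Type u} (G : SimpleGraph V) where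
  /-- the point that represents a vertex -/
  pos : V → ℝ × ℝ
  pos_injective : Function.Injective pos
  /-- the arc that represents an edge (its value at a non-edge is irrelevant) -/
  arc : Sym2 V → Set (ℝ × ℝ)
  isPlaneArc : ∀ x y, G.Adj x y → IsPlaneArc (arc s(x, y)) (pos x) (pos y)
  vertex_mem_arc : ∀ e ∈ G.edgeSet, ∀ w, pos w ∈ arc e → w ∈ e
  arc_inter_arc : ∀ e ∈ G.edgeSet, ∀ f ∈ G.edgeSet, e ≠ f →
    arc e ∩ arc f ⊆ Set.range pos

/-- A graph is planar if it can be drawn in the plane. -/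
def IsPlanarGraph {V : Type u} (G : SimpleGraph V) : Prop :=
  Nonempty (PlaneDrawing G)

/-- Every vertex has only finitely many neighbours. -/
def IsLocallyFiniteGraph {V : Type u} (G : SimpleGraph V) : Prop :=
  ∀ x, (G.neighborSet x).Finite

/-- The neighbourhood `N_G(S)` of a set `S` of vertices: the vertices outside `S` that have a
neighbour in `S`. -/
def setNeighbourhood {V : Type u} (G : SimpleGraph V) (S : Set V) : Set V :=
  {y | y ∉ S ∧ ∃ x ∈ S, G.Adj x y}

/-- An `A`--`B` path in `G`: a path whose only vertex in `A` is its first vertex and whose only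
vertex in `B` is its last vertex. A single vertex of `A ∩ B` is such a path. -/
structure SetPath {V : Type u} (G : SimpleGraph V) (A B : Set V) where
  /-- the first vertex -/
  first : V
  /-- the last vertex -/
  last : V
  /-- the path itself -/
  walk : G.Walk first last
  isPath : walk.IsPath
  inter_left : {x | x ∈ walk.support} ∩ A = {first}
  inter_right : {x | x ∈ walk.support} ∩ B = {last}

/-- There are `κ` pairwise disjoint `A`--`B` paths in `G`. -/
def HasDisjointSetPaths {V : Type u} (G : SimpleGraph V) (A B : Set V)
    (κ : Cardinal.{u}) : Prop :=
  ∃ (I : Type u) (P : I → SetPath G A B), Cardinal.mk I = κ ∧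
    ∀ i j, i ≠ j → ∀ x, x ∈ (P i).walk.support → x ∉ (P j).walk.support

/-- A tree-decomposition of `G` whose decomposition tree has node set `ι`. -/
structure TreeDecomp {V : Type u} (G : SimpleGraph V) (ι : Type v) where
  /-- the decomposition tree -/
  tree : SimpleGraph ι
  isTree : tree.IsTree
  /-- the parts -/
  bag : ι → Set V
  exists_mem_bag : ∀ x, ∃ t, x ∈ bag t
  exists_edge_bag : ∀ x y, G.Adj x y → ∃ t, x ∈ bag t ∧ y ∈ bag t
  bag_inter_bag : ∀ (s t : ι) (p : tree.Walk s t), p.IsPath →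
    ∀ r ∈ p.support, bag s ∩ bag t ⊆ bag r

/-- A rooted tree-decomposition of `G`: one whose decomposition tree has a root. -/
structure RootedTreeDecomp {V : Type u} (G : SimpleGraph V) (ι : Type v)
    extends TreeDecomp G ι where
  /-- the root of the decomposition tree -/
  root : ι

namespace TreeDecomp

variable {V : Type u} {G : SimpleGraph V} {ι : Type v}

/-- All parts are finite, that is, the width is less than `ℵ₀`. -/
def FiniteParts (D : TreeDecomp G ι) : Prop :=
  ∀ t, (D.bag t).Finite

/-- The adhesion set `V_e`, which is `V_s ∩ V_t` for an edge `e = st` of the tree. -/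
def adhesion (D : TreeDecomp G ι) (e : Sym2 ι) : Set V :=
  {x | ∀ t ∈ e, x ∈ D.bag t}

/-- For all nodes `s ≠ t` there are `min {|V_e| : e ∈ E(sTt)}` pairwise disjoint `V_s`--`V_t`
paths in `G`, where `sTt` is the path from `s` to `t` in the tree. -/
def StronglyLinked (D : TreeDecomp G ι) : Prop :=
  ∀ s t : ι, s ≠ t → ∀ p : D.tree.Walk s t, p.IsPath →
    ∃ κ : Cardinal.{u},
      IsLeast {c : Cardinal.{u} | ∃ e ∈ p.edges, c = Cardinal.mk (D.adhesion e)} κ ∧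
      HasDisjointSetPaths G (D.bag s) (D.bag t) κ

end TreeDecomp

namespace RootedTreeDecomp

variable {V : Type u} {G : SimpleGraph V} {ι : Type v}

/-- The node set of the component `T_e` of `T - e` that does not contain the root. For an edge
`e` the forest `T - e` has two components, so these are the nodes not joined to the root. -/
def nodesAbove (D : RootedTreeDecomp G ι) (e : Sym2 ι) : Set ι :=
  {t | ¬ (D.tree.deleteEdges {e}).Reachable D.root t}

/-- The vertex set of the part strictly above `e`: the union of all `V_t` with `t ∈ T_e`, minus
`V_e`. -/
def strictlyAbove (D : RootedTreeDecomp G ι) (e : Sym2 ι) : Set V :=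
  (⋃ t ∈ D.nodesAbove e, D.bag t) \ D.adhesion e

/-- All parts strictly above edges of the tree are connected. -/
def Componental (D : RootedTreeDecomp G ι) : Prop :=
  ∀ e ∈ D.tree.edgeSet, (G.induce (D.strictlyAbove e)).Connected

/-- For every edge `e` of the tree some component `C` of the part strictly above `e` has
neighbourhood `N_G(C) = V_e`. -/
def Tight (D : RootedTreeDecomp G ι) : Prop :=
  ∀ e ∈ D.tree.edgeSet, ∃ C : (G.induce (D.strictlyAbove e)).ConnectedComponent,
    setNeighbourhood G (Subtype.val '' C.supp) = D.adhesion e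

end RootedTreeDecomp

/-! The comb graph is a subgraph of the square grid whose left and right halves are joined only by
the spine edges from `(i, spineRow i)` to `(i + 1, spineRow i)`. Slits cut the far left into strips,
and for `n ≥ 1` the `n`-th strip is separated from the far right by `combCut n`, which has at most
`2 n + 3` vertices.

Suppose a decomposition with all the properties exists. By tightness and componentality, `V_e` is
the neighbourhood of the connected part strictly above `e`. With local finiteness, a finite set then
meets the part above `e`, adhesion set included, for only finitely many `e`. Hence tails of the
strip and of the right half lie strictly above tree edges whose parts avoid the cut. Strong
linkedness between the upper endnodes of these edges yields an edge `e` with `|V_e| ≤ 2 n + 3` whose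
adhesion set separates the two tails (`exists_edge_separating`).

There are also `2 n + 3` disjoint paths between the tails, so `|V_e| = 2 n + 3` and `V_e` meets each
path exactly once. The lowest path is doubled on both sides of a bottleneck at the first spine edge,
so `V_e` must meet it inside the bottleneck. This leaves `(-1, 0)` on the side of the left tail and
`(3, 0)` on the side of the right tail (`separates_bottleneck`). One tail is strictly above `e`,
hence so is one of these two vertices. The edges for different `n` differ in adhesion size, but a
vertex lies strictly above only finitely many edges: a contradiction. -/

namespace SimpleGraph

/-- A set that contains a vertex of `K` and is closed under adjacency within `K` contains all
of `K`. -/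
def IsLinkedSet {V : Type u} (G : SimpleGraph V) (K : Set V) : Prop :=
  ∀ S : Set V, (∃ x ∈ K, x ∈ S) → (∀ x ∈ S, ∀ y ∈ K, G.Adj x y → y ∈ S) → K ⊆ S

theorem isLinkedSet_of_induce_preconnected {V : Type u} {G : SimpleGraph V} {K : Set V}
    (h : (G.induce K).Preconnected) : G.IsLinkedSet K := by
  rintro S ⟨x, hxK, hxS⟩ hS y hy
  obtain ⟨w⟩ := h ⟨x, hxK⟩ ⟨y, hy⟩
  by_contra hyS
  obtain ⟨d, -, h1, h2⟩ := w.exists_boundary_dart {z | z.1 ∈ S} hxS hyS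
  exact h2 (hS _ h1 _ d.snd.2 d.adj)

end SimpleGraph

/-! ### Tree edges and the parts above them -/

namespace RootedTreeDecomp

variable {V : Type u} {G : SimpleGraph V} {ι : Type v} (D : RootedTreeDecomp G ι)

theorem adhesion_subset_bag {e : Sym2 ι} {t : ι} (ht : t ∈ e) : D.adhesion e ⊆ D.bag t :=
  fun _ hx => hx t ht

theorem finite_adhesion (hf : D.FiniteParts) (e : Sym2 ι) : (D.adhesion e).Finite := by
  induction e with
  | _ a b => exact (hf a).subset (D.adhesion_subset_bag (by simp))

theorem root_notMem_nodesAbove (e : Sym2 ι) : D.root ∉ D.nodesAbove e :=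
  fun h => h (SimpleGraph.Reachable.refl _)

theorem eq_edge_of_notMem_of_mem {e : Sym2 ι} {a b : ι} (hab : D.tree.Adj a b)
    (ha : a ∉ D.nodesAbove e) (hb : b ∈ D.nodesAbove e) : s(a, b) = e := by
  by_contra hne
  have ha' : (D.tree.deleteEdges {e}).Reachable D.root a := not_not.mp ha
  refine hb (ha'.trans (SimpleGraph.Adj.reachable ?_))
  simpa [SimpleGraph.deleteEdges_adj, hab] using hne

/-- An edge of the decomposition tree has a lower and an upper endnode. -/
theorem exists_lower_upper {e : Sym2 ι} (he : e ∈ D.tree.edgeSet) :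
    ∃ l u, D.tree.Adj l u ∧ e = s(l, u) ∧ l ∉ D.nodesAbove e ∧ u ∈ D.nodesAbove e ∧
      ∀ r ∈ D.nodesAbove e, (D.tree.deleteEdges {e}).Reachable u r := by
  have key : ∀ a b, D.tree.Adj a b → e = s(a, b) →
      ¬ (D.tree.deleteEdges {e}).Reachable a b ∧
      ∀ r, (D.tree.deleteEdges {e}).Reachable a r ∨ (D.tree.deleteEdges {e}).Reachable b r := by
    intro a b hab heq
    constructor
    · have := SimpleGraph.isAcyclic_iff_forall_adj_isBridge.mp D.isTree.isAcyclic hab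
      rw [SimpleGraph.isBridge_iff] at this
      rw [heq]
      exact this
    · intro r
      by_contra hr
      obtain ⟨w⟩ := D.isTree.connected.preconnected a r
      obtain ⟨d, -, h1, h2⟩ := w.exists_boundary_dart
        {x | (D.tree.deleteEdges {e}).Reachable a x ∨ (D.tree.deleteEdges {e}).Reachable b x}
        (Or.inl (SimpleGraph.Reachable.refl _)) hr
      by_cases hd : s(d.fst, d.snd) = e
      · rw [heq, Sym2.eq_iff] at hd
        rcases hd with ⟨-, h⟩ | ⟨-, h⟩
        · exact h2 (Or.inr (h ▸ SimpleGraph.Reachable.refl _))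
        · exact h2 (Or.inl (h ▸ SimpleGraph.Reachable.refl _))
      · have hadj : (D.tree.deleteEdges {e}).Adj d.fst d.snd := by
          simpa [SimpleGraph.deleteEdges_adj, d.adj] using hd
        exact h2 (h1.imp (·.trans hadj.reachable) (·.trans hadj.reachable))
  have main : ∀ a b, D.tree.Adj a b → e = s(a, b) →
      (D.tree.deleteEdges {e}).Reachable a D.root →
      D.tree.Adj a b ∧ e = s(a, b) ∧ a ∉ D.nodesAbove e ∧ b ∈ D.nodesAbove e ∧
      ∀ r ∈ D.nodesAbove e, (D.tree.deleteEdges {e}).Reachable b r := by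
    intro a b hab heq ha
    obtain ⟨h1, h2⟩ := key a b hab heq
    exact ⟨hab, heq, fun h => h ha.symm, fun h => h1 (ha.trans h),
      fun r hr => (h2 r).resolve_left fun h => hr (ha.symm.trans h)⟩
  induction e with
  | _ a b =>
    have hab : D.tree.Adj a b := he
    rcases (key a b hab rfl).2 D.root with h | h
    · exact ⟨a, b, main a b hab rfl h⟩
    · exact ⟨b, a, main b a hab.symm Sym2.eq_swap h⟩

theorem bag_subset_of_mem_nodesAbove {e : Sym2 ι} {t : ι} (ht : t ∈ D.nodesAbove e) :
    D.bag t ⊆ D.strictlyAbove e ∪ D.adhesion e := by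
  intro x hx
  by_cases h : x ∈ D.adhesion e
  · exact Or.inr h
  · exact Or.inl ⟨Set.mem_biUnion ht hx, h⟩

/-- All parts that contain a vertex strictly above `e` belong to nodes above `e`. -/
theorem mem_nodesAbove_of_mem_strictlyAbove {e : Sym2 ι} {x : V} (hx : x ∈ D.strictlyAbove e)
    {t : ι} (ht : x ∈ D.bag t) : t ∈ D.nodesAbove e := by
  classical
  by_contra hte
  obtain ⟨hx1, hx2⟩ := hx
  obtain ⟨r, hr, hxr⟩ := Set.mem_iUnion₂.mp hx1
  -- The tree path from `t` to `r` enters the nodes above `e`, hence runs through `e`. So `x` lies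
  -- in both end bags of `e`, that is, in the adhesion set.
  obtain ⟨w⟩ := D.isTree.connected.preconnected t r
  obtain ⟨d, hd, h1, h2⟩ := w.bypass.exists_boundary_dart {y | y ∉ D.nodesAbove e} hte
    (fun h => h hr)
  have hde := D.eq_edge_of_notMem_of_mem d.adj h1 (not_not.mp h2)
  refine hx2 fun y hy => ?_
  have hy' : y ∈ w.bypass.support := by
    rw [← hde, Sym2.mem_iff] at hy
    rcases hy with rfl | rfl
    · exact w.bypass.dart_fst_mem_support_of_mem_darts hd
    · exact w.bypass.dart_snd_mem_support_of_mem_darts hd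
  exact D.bag_inter_bag t r _ w.bypass_isPath y hy' ⟨ht, hxr⟩

/-- `u` is the upper endnode of the edge `e` of the decomposition tree. -/
def IsUpperNode (e : Sym2 ι) (u : ι) : Prop :=
  ∃ l, D.tree.Adj l u ∧ e = s(l, u) ∧ l ∉ D.nodesAbove e ∧ u ∈ D.nodesAbove e ∧
    ∀ r ∈ D.nodesAbove e, (D.tree.deleteEdges {e}).Reachable u r

variable {D}

theorem IsUpperNode.mem_edgeSet {e : Sym2 ι} {u : ι} (h : D.IsUpperNode e u) :
    e ∈ D.tree.edgeSet := by
  obtain ⟨l, hlu, rfl, -⟩ := h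
  exact hlu

theorem IsUpperNode.mem_nodesAbove {e : Sym2 ι} {u : ι} (h : D.IsUpperNode e u) :
    u ∈ D.nodesAbove e := by
  obtain ⟨l, -, -, -, hu, -⟩ := h
  exact hu

theorem IsUpperNode.mem_edge {e : Sym2 ι} {u : ι} (h : D.IsUpperNode e u) : u ∈ e := by
  obtain ⟨l, -, rfl, -⟩ := h
  simp

theorem IsUpperNode.eq_of_dart {e : Sym2 ι} {u a b : ι} (h : D.IsUpperNode e u)
    (hab : D.tree.Adj a b) (ha : a ∉ D.nodesAbove e) (hb : b ∈ D.nodesAbove e) : b = u := by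
  obtain ⟨l, -, he, hl, -⟩ := h
  have := D.eq_edge_of_notMem_of_mem hab ha hb
  rw [he, Sym2.eq_iff] at this
  rcases this with ⟨-, h⟩ | ⟨-, h⟩
  · exact h
  · subst h
    exact absurd hb hl

variable (D) in
theorem exists_isUpperNode {e : Sym2 ι} (he : e ∈ D.tree.edgeSet) : ∃ u, D.IsUpperNode e u := by
  obtain ⟨l, u, h⟩ := D.exists_lower_upper he
  exact ⟨u, l, h⟩

/-- In a subgraph of the decomposition tree, a node not above `e` that reaches a node above `e`
also reaches both endnodes of `e`. -/
theorem IsUpperNode.reachable_of_notMem {e : Sym2 ι} {u a b : ι} {H : SimpleGraph ι}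
    (hH : H ≤ D.tree) (h : D.IsUpperNode e u) (ha : a ∉ D.nodesAbove e)
    (hb : b ∈ D.nodesAbove e) (hab : H.Reachable a b) :
    H.Reachable a u ∧ ∃ l, e = s(l, u) ∧ l ∉ D.nodesAbove e ∧ H.Reachable a l := by
  classical
  obtain ⟨w⟩ := hab
  obtain ⟨d, hd, h1, h2⟩ := w.exists_boundary_dart {y | y ∉ D.nodesAbove e} ha (fun h => h hb)
  have h2' : d.snd ∈ D.nodesAbove e := not_not.mp h2
  have hu := h.eq_of_dart (hH d.adj) h1 h2'
  refine ⟨?_, d.fst, ?_, h1, ?_⟩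
  · rw [← hu]
    exact ⟨w.takeUntil _ (w.dart_snd_mem_support_of_mem_darts hd)⟩
  · rw [← hu]
    exact (D.eq_edge_of_notMem_of_mem (hH d.adj) h1 h2').symm
  · exact ⟨w.takeUntil _ (w.dart_fst_mem_support_of_mem_darts hd)⟩

theorem IsUpperNode.mem_nodesAbove_iff {e : Sym2 ι} {u r : ι} (h : D.IsUpperNode e u) :
    r ∈ D.nodesAbove e ↔ (D.tree.deleteEdges {e}).Reachable u r := by
  obtain ⟨l, -, -, -, hu, hr⟩ := h
  exact ⟨hr r, fun hur hroot => hu (SimpleGraph.Reachable.trans hroot hur.symm)⟩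

/-- If `r` is above `f` but not above `e`, the connection from `u` to `r` in `T - f` passes the
lower endnode `l` of `e`, so `l` is above `f`. The connection from the root to `l` in `T - e` then
enters the nodes above `f` through `u`, so `u` is not above `e`. -/
theorem IsUpperNode.nodesAbove_subset {e f : Sym2 ι} {u : ι} (he : e ∈ D.tree.edgeSet)
    (hf : D.IsUpperNode f u) (hue : u ∈ D.nodesAbove e) : D.nodesAbove f ⊆ D.nodesAbove e := by
  intro r hrf
  by_contra hre
  obtain ⟨v, hv⟩ := D.exists_isUpperNode he
  obtain ⟨-, l, -, hle, hl⟩ := hv.reachable_of_notMem (SimpleGraph.deleteEdges_le _) hre hue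
    (hf.mem_nodesAbove_iff.mp hrf).symm
  have hlf : l ∈ D.nodesAbove f :=
    hf.mem_nodesAbove_iff.mpr ((hf.mem_nodesAbove_iff.mp hrf).trans hl)
  exact hue (hf.reachable_of_notMem (SimpleGraph.deleteEdges_le _) (D.root_notMem_nodesAbove f)
    hlf (not_not.mp hle)).1

theorem IsUpperNode.strictlyAbove_subset {e f : Sym2 ι} {u : ι} (he : e ∈ D.tree.edgeSet)
    (hf : D.IsUpperNode f u) (hue : u ∈ D.nodesAbove e) :
    D.strictlyAbove f ⊆ D.strictlyAbove e := by
  intro x hx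
  obtain ⟨r, hr, hxr⟩ := Set.mem_iUnion₂.mp hx.1
  refine ⟨Set.mem_biUnion (hf.nodesAbove_subset he hue hr) hxr, fun hxe => ?_⟩
  obtain ⟨v, l, -, hel, hl, -⟩ := D.exists_isUpperNode he
  exact hl (hf.nodesAbove_subset he hue
    (D.mem_nodesAbove_of_mem_strictlyAbove hx (hxe l (by simp [hel]))))

/-- On a path of the decomposition tree every edge has exactly one endnode of the path above
it. -/
theorem mem_nodesAbove_of_mem_edges {s t : ι} {p : D.tree.Walk s t} (hp : p.IsPath)
    {e : Sym2 ι} (he : e ∈ p.edges) :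
    (s ∈ D.nodesAbove e ∧ t ∉ D.nodesAbove e) ∨ (s ∉ D.nodesAbove e ∧ t ∈ D.nodesAbove e) := by
  classical
  have key : ¬ (D.tree.deleteEdges {e}).Reachable s t := by
    rintro ⟨q⟩
    let q' : D.tree.Walk s t := q.bypass.mapLe (SimpleGraph.deleteEdges_le _)
    have hq' : q'.IsPath := (SimpleGraph.Walk.isPath_mapLe _).mpr q.bypass_isPath
    have : p = q' := congrArg Subtype.val
      ((D.isTree.isAcyclic.subsingleton_path s t).elim ⟨p, hp⟩ ⟨q', hq'⟩)
    rw [this] at he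
    have h2 : e ∈ q.bypass.edges := by simpa [q'] using he
    simpa [SimpleGraph.edgeSet_deleteEdges] using q.bypass.edges_subset_edgeSet h2
  obtain ⟨u, hu⟩ := D.exists_isUpperNode (p.edges_subset_edgeSet he)
  by_cases hs : s ∈ D.nodesAbove e <;> by_cases ht : t ∈ D.nodesAbove e
  · exact absurd ((hu.mem_nodesAbove_iff.mp hs).symm.trans (hu.mem_nodesAbove_iff.mp ht)) key
  · exact Or.inl ⟨hs, ht⟩
  · exact Or.inr ⟨hs, ht⟩
  · exact absurd ((not_not.mp hs : (D.tree.deleteEdges {e}).Reachable _ _).symm.trans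
      (not_not.mp ht)) key

/-! ### Finiteness for tight and componental decompositions -/

theorem isLinkedSet_strictlyAbove (hc : D.Componental) {e : Sym2 ι} (he : e ∈ D.tree.edgeSet) :
    G.IsLinkedSet (D.strictlyAbove e) :=
  SimpleGraph.isLinkedSet_of_induce_preconnected (hc e he).preconnected

/-- A connected part has only one component, so the component provided by tightness is the whole
part. -/
theorem setNeighbourhood_strictlyAbove (ht : D.Tight) (hc : D.Componental) {e : Sym2 ι}
    (he : e ∈ D.tree.edgeSet) :
    setNeighbourhood G (D.strictlyAbove e) = D.adhesion e := by
  obtain ⟨C, hC⟩ := ht e he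
  have : C.supp = Set.univ := by
    have := (hc e he).preconnected.subsingleton_connectedComponent
    ext x
    simp only [SimpleGraph.ConnectedComponent.mem_supp_iff, Set.mem_univ, iff_true]
    exact Subsingleton.elim _ _
  rw [this] at hC
  simpa using hC

/-- A walk in the tree from the root to a node whose bag contains `x` must use every such edge. The
final contradiction rests on this. -/
theorem finite_setOf_mem_strictlyAbove (x : V) :
    {e ∈ D.tree.edgeSet | x ∈ D.strictlyAbove e}.Finite := by
  classical
  obtain ⟨t, ht⟩ := D.exists_mem_bag x
  obtain ⟨w⟩ := D.isTree.connected.preconnected D.root t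
  refine (w.edges.toFinset.finite_toSet).subset fun e he => ?_
  simp only [List.coe_toFinset, Set.mem_ofPred_eq]
  by_contra hew
  refine D.mem_nodesAbove_of_mem_strictlyAbove he.2 ht ⟨w.toDeleteEdge e hew⟩

/-- A vertex of `V_e` has a neighbour strictly above `e`. It has finitely many neighbours, each
strictly above finitely many edges. -/
theorem finite_setOf_mem_adhesion (hl : IsLocallyFiniteGraph G) (ht : D.Tight)
    (hc : D.Componental) (x : V) :
    {e ∈ D.tree.edgeSet | x ∈ D.adhesion e}.Finite := by
  refine ((hl x).biUnion fun y _ => finite_setOf_mem_strictlyAbove (D := D) y).subset ?_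
  rintro e ⟨he, hx⟩
  rw [← setNeighbourhood_strictlyAbove ht hc he] at hx
  obtain ⟨-, y, hy, hyx⟩ := hx
  exact Set.mem_biUnion (show y ∈ G.neighborSet x from hyx.symm) ⟨he, hy⟩

theorem exists_mem_strictlyAbove (hf : D.FiniteParts) (hl : IsLocallyFiniteGraph G)
    (ht : D.Tight) (hc : D.Componental) {U : Set V} (hU : U.Finite) :
    ∃ W : Set V, W.Finite ∧ ∀ K : Set V, K.Nonempty → G.IsLinkedSet K → Disjoint K W →
      ∃ e ∈ D.tree.edgeSet, K ⊆ D.strictlyAbove e ∧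
        Disjoint (D.strictlyAbove e ∪ D.adhesion e) U := by
  classical
  let E : Set (Sym2 ι) :=
    ⋃ x ∈ U, ({e ∈ D.tree.edgeSet | x ∈ D.strictlyAbove e} ∪
      {e ∈ D.tree.edgeSet | x ∈ D.adhesion e})
  have hE : E.Finite := hU.biUnion fun x _ =>
    (finite_setOf_mem_strictlyAbove x).union (finite_setOf_mem_adhesion hl ht hc x)
  -- `W` contains the root bag and both end bags of every edge in `E`. A tree path from the root
  -- therefore leaves the nodes with bag inside `W` along an edge outside `E`; the adhesion set of
  -- that edge lies in `W`, so `K` cannot cross it.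
  refine ⟨D.bag D.root ∪ ⋃ e ∈ E, ⋃ t ∈ {t | t ∈ e}, D.bag t,
    (hf _).union (hE.biUnion fun e _ => Set.Finite.biUnion ?_ fun t _ => hf t), ?_⟩
  · exact e.toFinset.finite_toSet.subset fun t ht => by simpa using ht
  rintro K ⟨k, hk⟩ hK hKW
  set W := D.bag D.root ∪ ⋃ e ∈ E, ⋃ t ∈ {t | t ∈ e}, D.bag t with hW
  have hkW : k ∉ W := Set.disjoint_left.mp hKW hk
  obtain ⟨t, hkt⟩ := D.exists_mem_bag k
  obtain ⟨w⟩ := D.isTree.connected.preconnected D.root t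
  obtain ⟨d, hd, h1, h2⟩ := w.bypass.exists_boundary_dart {a | D.bag a ⊆ W}
    Set.subset_union_left (fun h => hkW (h hkt))
  have hde : d.edge ∈ D.tree.edgeSet := d.edge_mem
  have hdE : d.edge ∉ E := fun h => h2 fun x hx =>
    Or.inr (Set.mem_biUnion h (Set.mem_biUnion (Sym2.mem_mk_right d.fst d.snd) hx))
  have hadW : D.adhesion d.edge ⊆ W :=
    (D.adhesion_subset_bag (t := d.fst) (Sym2.mem_mk_left d.fst d.snd)).trans h1
  have htd : t ∈ D.nodesAbove d.edge :=
    ((mem_nodesAbove_of_mem_edges w.bypass_isPath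
      (List.mem_map_of_mem hd)).resolve_left fun h => D.root_notMem_nodesAbove _ h.1).2
  refine ⟨d.edge, hde, hK _ ⟨k, hk, (D.bag_subset_of_mem_nodesAbove htd hkt).resolve_right
    fun h => hkW (hadW h)⟩ ?_, ?_⟩
  · intro x hx y hy hxy
    by_contra hyn
    exact Set.disjoint_left.mp hKW hy (hadW (by
      rw [← setNeighbourhood_strictlyAbove ht hc hde]
      exact ⟨hyn, x, hx, hxy⟩))
  · rw [Set.disjoint_left]
    rintro x (hx | hx) hxU
    · exact hdE (Set.mem_biUnion hxU (Or.inl ⟨hde, hx⟩))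
    · exact hdE (Set.mem_biUnion hxU (Or.inr ⟨hde, hx⟩))

end RootedTreeDecomp

/-! ### A small adhesion set between two tails -/

theorem HasDisjointSetPaths.le_of_separates {V : Type u} {G : SimpleGraph V} {A B P Q U : Set V}
    {κ : Cardinal.{u}} (h : HasDisjointSetPaths G A B κ) (hA : A ⊆ P) (hB : B ⊆ Q)
    (hPQ : Disjoint P Q) (hP : ∀ x ∈ P, ∀ y, G.Adj x y → y ∈ P ∪ U) :
    κ ≤ Cardinal.mk U := by
  obtain ⟨I, p, rfl, hp⟩ := h
  have key : ∀ i, ∃ x ∈ U, x ∈ (p i).walk.support := by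
    intro i
    have h1 : (p i).first ∈ A := by
      have : (p i).first ∈ {x | x ∈ (p i).walk.support} ∩ A := by
        rw [(p i).inter_left]; exact Set.mem_singleton _
      exact this.2
    have h2 : (p i).last ∈ B := by
      have : (p i).last ∈ {x | x ∈ (p i).walk.support} ∩ B := by
        rw [(p i).inter_right]; exact Set.mem_singleton _
      exact this.2
    obtain ⟨d, hd, hd1, hd2⟩ := (p i).walk.exists_boundary_dart P (hA h1)
      (Set.disjoint_right.mp hPQ (hB h2))
    exact ⟨d.snd, (hP _ hd1 _ d.adj).resolve_left hd2,
      (p i).walk.dart_snd_mem_support_of_mem_darts hd⟩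
  choose f hfU hf using key
  refine Cardinal.mk_le_of_injective (f := fun i => (⟨f i, hfU i⟩ : U)) fun i j hij => ?_
  by_contra hne
  have : f i = f j := congrArg Subtype.val hij
  exact hp i j hne (f i) (hf i) (this ▸ hf j)

namespace RootedTreeDecomp

variable {V : Type u} {G : SimpleGraph V} {ι : Type v} {D : RootedTreeDecomp G ι}

/-- If a set above `e` lies on one side of a separator which the part above `e` avoids, then
the part above `e` lies on that side. -/
theorem strictlyAbove_union_adhesion_subset (ht : D.Tight) (hc : D.Componental) {e : Sym2 ι}
    (he : e ∈ D.tree.edgeSet) {K P U : Set V} (hK : K.Nonempty) (hKe : K ⊆ D.strictlyAbove e)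
    (hKP : K ⊆ P) (hP : ∀ x ∈ P, ∀ y, G.Adj x y → y ∈ P ∪ U)
    (hU : Disjoint (D.strictlyAbove e ∪ D.adhesion e) U) :
    D.strictlyAbove e ∪ D.adhesion e ⊆ P := by
  have h1 : D.strictlyAbove e ⊆ P := by
    obtain ⟨k, hk⟩ := hK
    refine isLinkedSet_strictlyAbove hc he P ⟨k, hKe hk, hKP hk⟩ fun x hx y hy hxy => ?_
    exact (hP x hx y hxy).resolve_right (Set.disjoint_left.mp hU (Or.inl hy))
  rintro y (hy | hy)
  · exact h1 hy
  · have hy' := hy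
    rw [← setNeighbourhood_strictlyAbove ht hc he] at hy'
    obtain ⟨-, x, hx, hxy⟩ := hy'
    exact (hP x (h1 hx) y hxy).resolve_right (Set.disjoint_left.mp hU (Or.inr hy))

theorem adhesion_nonempty (ht : D.Tight) (hc : D.Componental) (hG : G.Connected) {e : Sym2 ι}
    (he : e ∈ D.tree.edgeSet) {x y : V} (hx : x ∈ D.strictlyAbove e)
    (hy : y ∉ D.strictlyAbove e) : (D.adhesion e).Nonempty := by
  obtain ⟨w⟩ := hG.preconnected x y
  obtain ⟨d, -, h1, h2⟩ := w.exists_boundary_dart _ hx hy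
  refine ⟨d.snd, ?_⟩
  rw [← setNeighbourhood_strictlyAbove ht hc he]
  exact ⟨h2, d.fst, h1, d.adj⟩

/-- A common vertex would give a node above both `e` and `g`. The connection to it from `t` in `T -
g` enters the nodes above `e` through the upper endnode of `e`, which is thus above `g`. Then
everything above `e`, in particular `s`, is above `g`. -/
theorem IsUpperNode.disjoint_strictlyAbove {e g : Sym2 ι} {s t : ι} (he : e ∈ D.tree.edgeSet)
    (hg : D.IsUpperNode g t) (hse : s ∈ D.nodesAbove e)
    (hte : t ∉ D.nodesAbove e) (hsg : s ∉ D.nodesAbove g) :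
    Disjoint (D.strictlyAbove g) (D.strictlyAbove e ∪ D.adhesion e) := by
  obtain ⟨u, hu⟩ := D.exists_isUpperNode he
  rw [Set.disjoint_left]
  intro x hxg hxe
  obtain ⟨r, hr, hxr⟩ : ∃ r ∈ D.nodesAbove e, x ∈ D.bag r := by
    rcases hxe with hxe | hxe
    · obtain ⟨r, hr, hxr⟩ := Set.mem_iUnion₂.mp hxe.1
      exact ⟨r, hr, hxr⟩
    · exact ⟨u, hu.mem_nodesAbove, hxe u hu.mem_edge⟩
  have hrg := D.mem_nodesAbove_of_mem_strictlyAbove hxg hxr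
  have htu := (hu.reachable_of_notMem (SimpleGraph.deleteEdges_le _) hte hr
    (hg.mem_nodesAbove_iff.mp hrg)).1
  exact hsg (hu.nodesAbove_subset hg.mem_edgeSet (hg.mem_nodesAbove_iff.mpr htu) hse)

theorem exists_edge_separating (hf : D.FiniteParts) (hl : IsLocallyFiniteGraph G) (ht : D.Tight)
    (hc : D.Componental) (hs : D.StronglyLinked) (hG : G.Connected) {U P Q : Set V}
    (hU : U.Finite) (hPQ : Disjoint P Q) (hP : ∀ x ∈ P, ∀ y, G.Adj x y → y ∈ P ∪ U)
    (hQ : ∀ x ∈ Q, ∀ y, G.Adj x y → y ∈ Q ∪ U) {K L : ℕ → Set V}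
    (hK : ∀ c, (K c).Nonempty ∧ G.IsLinkedSet (K c) ∧ K c ⊆ P)
    (hL : ∀ c, (L c).Nonempty ∧ G.IsLinkedSet (L c) ∧ L c ⊆ Q)
    (hKW : ∀ W : Set V, W.Finite → ∃ c, Disjoint (K c) W)
    (hLW : ∀ W : Set V, W.Finite → ∃ c, Disjoint (L c) W) :
    ∃ e ∈ D.tree.edgeSet, Cardinal.mk (D.adhesion e) ≤ Cardinal.mk U ∧ ∃ c d,
      (K c ⊆ D.strictlyAbove e ∧ Disjoint (L d) (D.strictlyAbove e ∪ D.adhesion e)) ∨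
      (L d ⊆ D.strictlyAbove e ∧ Disjoint (K c) (D.strictlyAbove e ∪ D.adhesion e)) := by
  obtain ⟨W, hW, hWe⟩ := exists_mem_strictlyAbove hf hl ht hc hU
  obtain ⟨c, hcW⟩ := hKW W hW
  obtain ⟨d, hdW⟩ := hLW W hW
  obtain ⟨f, hfE, hKf, hfU⟩ := hWe (K c) (hK c).1 (hK c).2.1 hcW
  obtain ⟨g, hgE, hLg, hgU⟩ := hWe (L d) (hL d).1 (hL d).2.1 hdW
  have hfP := strictlyAbove_union_adhesion_subset ht hc hfE (hK c).1 hKf (hK c).2.2 hP hfU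
  have hgQ := strictlyAbove_union_adhesion_subset ht hc hgE (hL d).1 hLg (hL d).2.2 hQ hgU
  obtain ⟨k, hk⟩ := (hK c).1
  obtain ⟨l, hl'⟩ := (hL d).1
  obtain ⟨x, hx⟩ : (D.adhesion f).Nonempty := adhesion_nonempty ht hc hG hfE (hKf hk)
    fun h => Set.disjoint_left.mp hPQ (hfP (Or.inl h)) (hgQ (Or.inl (hLg hl')))
  obtain ⟨y, hy⟩ : (D.adhesion g).Nonempty := adhesion_nonempty ht hc hG hgE (hLg hl')
    fun h => Set.disjoint_left.mp hPQ (hfP (Or.inl (hKf hk))) (hgQ (Or.inl h))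
  obtain ⟨s, hs'⟩ := D.exists_isUpperNode hfE
  obtain ⟨t, ht'⟩ := D.exists_isUpperNode hgE
  have hsP : D.bag s ⊆ P := (D.bag_subset_of_mem_nodesAbove hs'.mem_nodesAbove).trans hfP
  have htQ : D.bag t ⊆ Q := (D.bag_subset_of_mem_nodesAbove ht'.mem_nodesAbove).trans hgQ
  have hxs : x ∈ D.bag s := hx s hs'.mem_edge
  have hyt : y ∈ D.bag t := hy t ht'.mem_edge
  have hsg : s ∉ D.nodesAbove g := fun h => Set.disjoint_left.mp hPQ (hsP hxs)
    (hgQ (D.bag_subset_of_mem_nodesAbove h hxs))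
  have htf : t ∉ D.nodesAbove f := fun h => Set.disjoint_left.mp hPQ
    (hfP (D.bag_subset_of_mem_nodesAbove h hyt)) (htQ hyt)
  have hst : s ≠ t := by
    rintro rfl
    exact hsg ht'.mem_nodesAbove
  obtain ⟨p, hp⟩ := D.isTree.connected.exists_isPath s t
  -- The edge `e` attains the minimum adhesion size on the tree path. As many disjoint paths run
  -- from `V_s ⊆ P` to `V_t ⊆ Q`, and each of them meets `U`.
  obtain ⟨κ, ⟨⟨e, hep, rfl⟩, -⟩, hκ⟩ := hs s t hst p hp
  have heE := p.edges_subset_edgeSet hep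
  refine ⟨e, heE, hκ.le_of_separates hsP htQ hPQ hP, c, d, ?_⟩
  rcases mem_nodesAbove_of_mem_edges hp hep with ⟨h1, h2⟩ | ⟨h1, h2⟩
  · exact Or.inl ⟨hKf.trans (hs'.strictlyAbove_subset heE h1),
      (ht'.disjoint_strictlyAbove heE h1 h2 hsg).mono_left hLg⟩
  · exact Or.inr ⟨hLg.trans (ht'.strictlyAbove_subset heE h2),
      (hs'.disjoint_strictlyAbove heE h2 h1 htf).mono_left hKf⟩

end RootedTreeDecomp

/-! ### A decomposition into finite parts along a ray -/

/-- A graph with a vertex labelling by natural numbers whose fibres are finite and which changes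
by at most one along edges has a tree-decomposition into finite parts. -/
theorem exists_treeDecomp_finiteParts {V : Type u} {G : SimpleGraph V} (N : V → ℕ)
    (hN : ∀ n, {x | N x = n}.Finite) (hadj : ∀ x y, G.Adj x y → N x ≤ N y + 1) :
    ∃ D : TreeDecomp G ℕ, D.FiniteParts := by
  have hadj' : ∀ a b, (SimpleGraph.hasse ℕ).Adj a b ↔ a + 1 = b ∨ b + 1 = a := by
    intro a b
    simp [SimpleGraph.hasse_adj, Order.covBy_iff_add_one_eq]
  have htree : (SimpleGraph.hasse ℕ).IsTree := by
    refine ⟨⟨SimpleGraph.hasse_preconnected_of_succ ℕ⟩, ?_⟩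
    rw [SimpleGraph.isAcyclic_iff_forall_adj_isBridge]
    have key : ∀ a, (SimpleGraph.hasse ℕ).IsBridge s(a, a + 1) := by
      intro a
      rw [SimpleGraph.isBridge_iff]
      rintro ⟨w⟩
      obtain ⟨d, -, h1, h2⟩ := w.exists_boundary_dart {n | n ≤ a} (by simp) (by simp)
      have h3 := d.adj
      simp only [SimpleGraph.deleteEdges_adj, hadj', Set.mem_singleton_iff] at h3
      simp only [Set.mem_ofPred_eq, not_le] at h1 h2
      have h4 : d.fst = a := by omega
      have h5 : d.snd = a + 1 := by omega
      exact h3.2 (by rw [h4, h5])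
    intro a b hab
    rcases (hadj' a b).mp hab with rfl | rfl
    · exact key a
    · rw [Sym2.eq_swap]
      exact key b
  refine ⟨⟨SimpleGraph.hasse ℕ, htree, fun n => {x | N x = n ∨ N x = n + 1},
    fun x => ⟨N x, Or.inl rfl⟩, fun x y hxy => ?_, ?_⟩, fun n => ?_⟩
  · have h1 := hadj x y hxy
    have h2 := hadj y x hxy.symm
    refine ⟨min (N x) (N y), ?_⟩
    simp only [Set.mem_ofPred_eq]
    omega
  · rintro s t p hp r hr x ⟨hs, ht⟩
    -- Parts consist of two consecutive levels, so a common vertex forces `|s - t| ≤ 1`; the path is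
    -- trivial or a single edge.
    have key : r = s ∨ r = t := by
      by_cases hst : s = t
      · subst hst
        rw [SimpleGraph.Walk.isPath_iff_nil, ← SimpleGraph.Walk.eq_nil_iff_nil] at hp
        subst hp
        simpa using hr
      · have hadj₂ : (SimpleGraph.hasse ℕ).Adj s t := by
          rw [hadj']
          simp only [Set.mem_ofPred_eq] at hs ht
          omega
        have : p = hadj₂.toWalk := congrArg Subtype.val
          ((htree.isAcyclic.subsingleton_path s t).elim ⟨p, hp⟩
            ⟨hadj₂.toWalk, by simp [hst]⟩)
        subst this
        simpa using hr
    rcases key with rfl | rfl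
    · exact hs
    · exact ht
  · exact (hN n).union (hN (n + 1))

/-! ### Induced subgraphs of the square grid -/

/-- The square grid on `ℤ × ℤ`. -/
def squareGrid : SimpleGraph (ℤ × ℤ) where
  Adj p q := (p.1 = q.1 ∧ (p.2 + 1 = q.2 ∨ q.2 + 1 = p.2)) ∨
    (p.2 = q.2 ∧ (p.1 + 1 = q.1 ∨ q.1 + 1 = p.1))
  symm.symm p q h := by omega
  loopless.irrefl p h := by omega

theorem squareGrid_adj {p q : ℤ × ℤ} : squareGrid.Adj p q ↔
    (p.1 = q.1 ∧ (p.2 + 1 = q.2 ∨ q.2 + 1 = p.2)) ∨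
      (p.2 = q.2 ∧ (p.1 + 1 = q.1 ∨ q.1 + 1 = p.1)) :=
  Iff.rfl

/-- The point of the plane at which a vertex of the grid is drawn. -/
def gridPoint (p : ℤ × ℤ) : ℝ × ℝ := (p.1, p.2)

theorem gridPoint_injective : Function.Injective gridPoint := by
  rintro ⟨a, b⟩ ⟨c, d⟩ h
  simp only [gridPoint, Prod.mk.injEq, Int.cast_inj] at h
  exact Prod.ext h.1 h.2

theorem isPlaneArc_segment {p q : ℝ × ℝ} (h : p ≠ q) : IsPlaneArc (segment ℝ p q) p q := by
  refine ⟨fun t => AffineMap.lineMap p q (t : ℝ), ?_, ?_, by simp, by simp, ?_⟩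
  · exact AffineMap.lineMap_continuous.comp continuous_subtype_val
  · exact (AffineMap.lineMap_injective ℝ h).comp Subtype.val_injective
  · rw [segment_eq_image_lineMap]
    ext x
    simp [unitInterval]

theorem floor_ceil_of_mem_Ioo {a : ℝ} {n : ℤ} (h1 : (n : ℝ) < a) (h2 : a < n + 1) :
    ⌊a⌋ = n ∧ ⌈a⌉ = n + 1 := by
  refine ⟨Int.floor_eq_iff.mpr ⟨h1.le, h2⟩, Int.ceil_eq_iff.mpr ⟨?_, ?_⟩⟩
  · push_cast; linarith
  · push_cast; linarith

/-- A point in the interior of a grid edge determines the edge. -/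
theorem eq_or_eq_of_mem_segment {u v : ℤ × ℤ} (h : squareGrid.Adj u v) {p : ℝ × ℝ}
    (hp : p ∈ segment ℝ (gridPoint u) (gridPoint v)) :
    p = gridPoint u ∨ p = gridPoint v ∨
      s(u, v) = s((⌊p.1⌋, ⌊p.2⌋), (⌈p.1⌉, ⌈p.2⌉)) := by
  have key : ∀ u v : ℤ × ℤ, (u.1 = v.1 ∧ u.2 + 1 = v.2 ∨ u.2 = v.2 ∧ u.1 + 1 = v.1) →
      p ∈ segment ℝ (gridPoint u) (gridPoint v) →
      p = gridPoint u ∨ p = gridPoint v ∨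
        s(u, v) = s((⌊p.1⌋, ⌊p.2⌋), (⌈p.1⌉, ⌈p.2⌉)) := by
    rintro ⟨a, b⟩ ⟨c, d⟩ h hp
    rw [segment_eq_image] at hp
    obtain ⟨θ, ⟨h0, h1⟩, rfl⟩ := hp
    rcases h0.eq_or_lt with rfl | h0
    · left; simp
    rcases h1.eq_or_lt with rfl | h1
    · right; left; simp
    right; right
    simp only at h
    rcases h with ⟨rfl, rfl⟩ | ⟨rfl, rfl⟩
    · have e1 : (1 - θ) * (a : ℝ) + θ * a = a := by ring
      obtain ⟨h2, h3⟩ := floor_ceil_of_mem_Ioo (n := b) (a := (1 - θ) * b + θ * (b + 1))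
        (by linarith) (by linarith)
      simp [gridPoint, e1, h2, h3]
    · have e1 : (1 - θ) * (b : ℝ) + θ * b = b := by ring
      obtain ⟨h2, h3⟩ := floor_ceil_of_mem_Ioo (n := a) (a := (1 - θ) * a + θ * (a + 1))
        (by linarith) (by linarith)
      simp [gridPoint, e1, h2, h3]
  by_cases huv : u.1 = v.1 ∧ u.2 + 1 = v.2 ∨ u.2 = v.2 ∧ u.1 + 1 = v.1
  · exact key u v huv hp
  · rw [segment_symm] at hp
    have := key v u (by rw [squareGrid_adj] at h; omega) hp
    rw [Sym2.eq_swap]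
    tauto

theorem isPlanarGraph_induce_squareGrid (R : Set (ℤ × ℤ)) :
    IsPlanarGraph (squareGrid.induce R) := by
  have hpos : Function.Injective fun v : R => gridPoint v.1 :=
    gridPoint_injective.comp Subtype.val_injective
  have harc : ∀ x y : R, convexHull ℝ ((fun v : R => gridPoint v.1) '' {v | v ∈ s(x, y)}) =
      segment ℝ (gridPoint x.1) (gridPoint y.1) := by
    intro x y
    rw [← convexHull_pair]
    congr 1
    ext p
    simp [eq_comm]
  -- The convex hull describes a segment by its unordered pair of ends, so no orientation of the
  -- edge has to be chosen.
  refine ⟨⟨fun v => gridPoint v.1, hpos,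
    fun e => convexHull ℝ ((fun v : R => gridPoint v.1) '' {v | v ∈ e}), ?_, ?_, ?_⟩⟩
  · intro x y hxy
    rw [harc]
    exact isPlaneArc_segment (hpos.ne hxy.ne)
  · intro e he w hw
    induction e with
    | _ x y =>
      rw [harc] at hw
      rcases eq_or_eq_of_mem_segment he hw with h | h | h
      · simp [hpos h]
      · simp [hpos h]
      · have he' : squareGrid.Adj x.1 y.1 := he
        simp only [gridPoint, Int.floor_intCast, Int.ceil_intCast, Sym2.eq_iff] at h
        rcases h with ⟨h1, h2⟩ | ⟨h1, h2⟩ <;>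
          exact absurd (h1.trans h2.symm) he'.ne
  · rintro e he f hf hef p ⟨hpe, hpf⟩
    induction e with
    | _ x y =>
    induction f with
    | _ z w =>
      rw [harc] at hpe hpf
      rcases eq_or_eq_of_mem_segment he hpe with rfl | rfl | h
      · exact ⟨x, rfl⟩
      · exact ⟨y, rfl⟩
      rcases eq_or_eq_of_mem_segment hf hpf with rfl | rfl | h'
      · exact ⟨z, rfl⟩
      · exact ⟨w, rfl⟩
      refine absurd (Sym2.map.injective Subtype.val_injective ?_) hef
      simpa using h.trans h'.symm

theorem isLocallyFiniteGraph_induce_squareGrid (R : Set (ℤ × ℤ)) :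
    IsLocallyFiniteGraph (squareGrid.induce R) := by
  intro x
  refine Set.Finite.of_finite_image (f := Subtype.val) ?_ Subtype.val_injective.injOn
  refine ((Set.finite_Icc (x.1.1 - 1) (x.1.1 + 1)).prod
    (Set.finite_Icc (x.1.2 - 1) (x.1.2 + 1))).subset ?_
  rintro _ ⟨y, hy, rfl⟩
  have : squareGrid.Adj x.1 y.1 := hy
  rw [squareGrid_adj] at this
  simp only [Set.mem_prod, Set.mem_Icc]
  omega

theorem exists_treeDecomp_induce_squareGrid (R : Set (ℤ × ℤ)) :
    ∃ D : TreeDecomp (squareGrid.induce R) ℕ, D.FiniteParts := by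
  refine exists_treeDecomp_finiteParts (fun x => x.1.1.natAbs + x.1.2.natAbs) (fun n => ?_) ?_
  · refine Set.Finite.of_finite_image (f := Subtype.val) ?_ Subtype.val_injective.injOn
    refine ((Set.finite_Icc (-n : ℤ) n).prod (Set.finite_Icc (-n : ℤ) n)).subset ?_
    rintro _ ⟨y, hy, rfl⟩
    simp only [Set.mem_ofPred_eq] at hy
    simp only [Set.mem_prod, Set.mem_Icc]
    omega
  · intro x y hxy
    have : squareGrid.Adj x.1 y.1 := hxy
    rw [squareGrid_adj] at this
    omega

/-! ### Moving along rows and columns off a separator -/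

/-- A set of grid points is closed in the subgrid on `R` off the separator `X`. -/
def IsClosedOff (R X C : Set (ℤ × ℤ)) : Prop :=
  ∀ p ∈ C, ∀ q ∈ R, q ∉ X → squareGrid.Adj p q → q ∈ C

namespace IsClosedOff

variable {R X C : Set (ℤ × ℤ)}

theorem row (hC : IsClosedOff R X C) {x₀ x₁ y : ℤ}
    (h : ∀ x, min x₀ x₁ ≤ x → x ≤ max x₀ x₁ → (x, y) ∈ R \ X) (h₀ : (x₀, y) ∈ C) :
    (x₁, y) ∈ C := by
  rcases le_total x₀ x₁ with hle | hle
  · have key : ∀ x, x₀ ≤ x → x ≤ x₁ → (x, y) ∈ C := by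
      intro x hx
      induction x, hx using Int.leInduction with
      | base => exact fun _ => h₀
      | succ x hx ih =>
        intro hx'
        have := h (x + 1) (by omega) (by omega)
        exact hC _ (ih (by omega)) _ this.1 this.2 (by simp [squareGrid_adj])
    exact key x₁ hle le_rfl
  · have key : ∀ x, x ≤ x₀ → x₁ ≤ x → (x, y) ∈ C := by
      intro x hx
      induction x, hx using Int.leInductionDown with
      | base => exact fun _ => h₀
      | pred x hx ih =>
        intro hx'
        have := h (x - 1) (by omega) (by omega)
        exact hC _ (ih (by omega)) _ this.1 this.2 (by simp [squareGrid_adj])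
    exact key x₁ hle le_rfl

theorem column (hC : IsClosedOff R X C) {x y₀ y₁ : ℤ}
    (h : ∀ y, min y₀ y₁ ≤ y → y ≤ max y₀ y₁ → (x, y) ∈ R \ X) (h₀ : (x, y₀) ∈ C) :
    (x, y₁) ∈ C := by
  rcases le_total y₀ y₁ with hle | hle
  · have key : ∀ y, y₀ ≤ y → y ≤ y₁ → (x, y) ∈ C := by
      intro y hy
      induction y, hy using Int.leInduction with
      | base => exact fun _ => h₀
      | succ y hy ih =>
        intro hy'
        have := h (y + 1) (by omega) (by omega)
        exact hC _ (ih (by omega)) _ this.1 this.2 (by simp [squareGrid_adj])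
    exact key y₁ hle le_rfl
  · have key : ∀ y, y ≤ y₀ → y₁ ≤ y → (x, y) ∈ C := by
      intro y hy
      induction y, hy using Int.leInductionDown with
      | base => exact fun _ => h₀
      | pred y hy ih =>
        intro hy'
        have := h (y - 1) (by omega) (by omega)
        exact hC _ (ih (by omega)) _ this.1 this.2 (by simp [squareGrid_adj])
    exact key y₁ hle le_rfl

end IsClosedOff

theorem isLinkedSet_preimage_of_box {R K : Set (ℤ × ℤ)}
    (hK : ∀ p ∈ K, ∀ q ∈ K, ∀ r : ℤ × ℤ, min p.1 q.1 ≤ r.1 → r.1 ≤ max p.1 q.1 →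
      min p.2 q.2 ≤ r.2 → r.2 ≤ max p.2 q.2 → r ∈ K) (hKR : K ⊆ R) :
    (squareGrid.induce R).IsLinkedSet (Subtype.val ⁻¹' K) := by
  rintro S ⟨x, hxK, hxS⟩ hS y hy
  have hC : IsClosedOff K ∅ (Subtype.val '' S) := by
    rintro _ ⟨p, hp, rfl⟩ q hq - hpq
    exact ⟨⟨q, hKR hq⟩, hS p hp ⟨q, hKR hq⟩ hq hpq, rfl⟩
  have h1 : (y.1.1, x.1.2) ∈ Subtype.val '' S :=
    hC.row (x₀ := x.1.1) (fun z h1 h2 => ⟨hK x.1 hxK y.1 hy (z, x.1.2) h1 h2 (by simp)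
      (by simp), Set.notMem_empty _⟩) ⟨x, hxS, rfl⟩
  have h2 : (y.1.1, y.1.2) ∈ Subtype.val '' S :=
    hC.column (fun z h1 h2 => ⟨hK x.1 hxK y.1 hy (y.1.1, z) (by simp) (by simp) h1 h2,
      Set.notMem_empty _⟩) h1
  obtain ⟨z, hz, hzy⟩ := h2
  rwa [← Subtype.ext (show z.1 = y.1 from hzy)]

/-! ### The comb graph -/

/-- The rows in which the two halves of the comb graph are joined. -/
def spineRow (n : ℤ) : ℤ := n ^ 2 + 5 * n

theorem spineRow_zero : spineRow 0 = 0 := by simp [spineRow]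

/-- The difference of the two values is `(b - a) (a + b + 5)`. For `b = a + 1` the bound is
attained, which leaves exactly `2 b + 4` rows between the slits of index `a` and `b`. -/
theorem spineRow_lt {a b : ℤ} (ha : 0 ≤ a) (hab : a < b) :
    spineRow a + a + b + 5 ≤ spineRow b := by
  unfold spineRow
  nlinarith [mul_nonneg ha (sub_nonneg.mpr hab.le), mul_nonneg (sub_nonneg.mpr hab.le)
    (sub_nonneg.mpr (Int.add_one_le_iff.mpr hab))]

theorem spineRow_le {a b : ℤ} (ha : 0 ≤ a) (hab : a ≤ b) : spineRow a ≤ spineRow b := by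
  rcases hab.eq_or_lt with rfl | h
  · exact le_rfl
  · have := spineRow_lt ha h
    omega

/-- The vertex set of the comb graph: the upper half-plane grid without the gaps that separate
the two halves between consecutive spine rows, and without infinite slits on the left. -/
def combRegion : Set (ℤ × ℤ) :=
  {p | 0 ≤ p.2 ∧ ¬ (1 ≤ p.1 ∧ spineRow (p.1 - 1) < p.2 ∧ p.2 < spineRow p.1) ∧
    ¬ (p.1 ≤ -2 ∧ ∃ n, 0 ≤ n ∧ p.2 = spineRow n + n + 3)}

/-- The comb graph. -/
abbrev combGraph : SimpleGraph combRegion := squareGrid.induce combRegion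

theorem mem_combRegion {x y : ℤ} : (x, y) ∈ combRegion ↔ 0 ≤ y ∧
    ¬ (1 ≤ x ∧ spineRow (x - 1) < y ∧ y < spineRow x) ∧
    ¬ (x ≤ -2 ∧ ∃ n, 0 ≤ n ∧ y = spineRow n + n + 3) := Iff.rfl

theorem mem_combRegion_of_le {x y : ℤ} (hx : -1 ≤ x) (hy : 0 ≤ y) (h : 1 ≤ x → spineRow x ≤ y) :
    (x, y) ∈ combRegion := by
  rw [mem_combRegion]
  exact ⟨hy, fun h' => by have := h h'.1; omega, by omega⟩

theorem mem_combRegion_of_ge {x y : ℤ} (hx : 1 ≤ x) (hy : 0 ≤ y) (h : y ≤ spineRow (x - 1)) :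
    (x, y) ∈ combRegion := by
  rw [mem_combRegion]
  exact ⟨hy, by omega, by omega⟩

theorem spineRow_mem_combRegion {x n : ℤ} (hn : 0 ≤ n) (hx : -1 ≤ x) :
    (x, spineRow n) ∈ combRegion := by
  have h0 := spineRow_le le_rfl hn
  rw [spineRow_zero] at h0
  rcases le_or_gt x n with h | h
  · exact mem_combRegion_of_le hx h0 fun h' => spineRow_le (by omega) h
  · exact mem_combRegion_of_ge (by omega) h0 (spineRow_le hn (by omega))

theorem mem_combRegion_of_between {x y n : ℤ} (hn : 1 ≤ n) (hx : x ≤ 0)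
    (h1 : spineRow n - n - 1 ≤ y) (h2 : y ≤ spineRow n + n + 2) : (x, y) ∈ combRegion := by
  have h0 := spineRow_lt le_rfl (show 0 < n by omega)
  rw [spineRow_zero] at h0
  rw [mem_combRegion]
  refine ⟨by omega, by omega, ?_⟩
  rintro ⟨-, m, hm, rfl⟩
  rcases lt_trichotomy m n with h | rfl | h
  · have := spineRow_lt hm h
    omega
  · omega
  · have := spineRow_lt (by omega) h
    omega

theorem combGraph_connected : combGraph.Connected := by
  have h0 : ((-1, 0) : ℤ × ℤ) ∈ combRegion := mem_combRegion_of_le (by simp) (by simp) (by simp)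
  suffices h : ∀ x : combRegion, combGraph.Reachable x ⟨(-1, 0), h0⟩ from
    { preconnected := fun x y => (h x).trans (h y).symm
      nonempty := ⟨⟨_, h0⟩⟩ }
  rintro ⟨⟨x, y⟩, hxy⟩
  let C : Set (ℤ × ℤ) := {p | ∃ hp : p ∈ combRegion, combGraph.Reachable ⟨(x, y), hxy⟩ ⟨p, hp⟩}
  have hC : IsClosedOff combRegion ∅ C := by
    rintro p ⟨hp, h⟩ q hq - hpq
    exact ⟨hq, h.trans (SimpleGraph.Adj.reachable hpq)⟩
  have hstart : (x, y) ∈ C := ⟨hxy, SimpleGraph.Reachable.refl _⟩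
  obtain ⟨hy, hgap, hslit⟩ := mem_combRegion.mp hxy
  have hcol : ∀ z, 0 ≤ z → (-1, z) ∈ C → (-1, 0) ∈ C := fun z hz h =>
    hC.column (fun w h1 _ => ⟨mem_combRegion_of_le (by omega) (by omega) (by omega),
      Set.notMem_empty _⟩) h
  suffices (-1, 0) ∈ C from this.2
  by_cases hx : x ≤ -1
  · refine hcol y hy (hC.row (fun z h1 h2 => ⟨?_, Set.notMem_empty _⟩) hstart)
    rw [mem_combRegion]
    refine ⟨hy, by omega, ?_⟩
    rintro ⟨h3, h4⟩
    exact hslit ⟨by omega, h4⟩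
  by_cases hA : 1 ≤ x → spineRow x ≤ y
  · refine hcol y hy (hC.row (fun z h1 h2 => ⟨?_, Set.notMem_empty _⟩) hstart)
    refine mem_combRegion_of_le (by omega) hy fun hz => ?_
    have := spineRow_le (show 0 ≤ z by omega) (show z ≤ x by omega)
    have := hA (by omega)
    omega
  -- The point is in the right half: go up to the spine row `x - 1` and cross to the left half along
  -- it.
  · have h1 : (x, spineRow (x - 1)) ∈ C :=
      hC.column (fun z h1 h2 => ⟨mem_combRegion_of_ge (by omega) (by omega) (by omega),
        Set.notMem_empty _⟩) hstart
    have h2 := spineRow_le le_rfl (show 0 ≤ x - 1 by omega)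
    rw [spineRow_zero] at h2
    exact hcol _ h2 (hC.row (fun z h1 h2 => ⟨spineRow_mem_combRegion (by omega) (by omega),
      Set.notMem_empty _⟩) h1)

/-! ### Tails and the cut between them -/

/-- The part of the strip between two consecutive slits that lies far to the left. -/
def leftTail (n : ℤ) (c : ℕ) : Set (ℤ × ℤ) :=
  {p | p.1 ≤ -2 - c ∧ spineRow n - n - 1 ≤ p.2 ∧ p.2 ≤ spineRow n + n + 2}

/-- A strip far to the right. -/
def rightTail (n : ℤ) (c : ℕ) : Set (ℤ × ℤ) :=
  {p | 2 * n + 4 + c ≤ p.1 ∧ 0 ≤ p.2 ∧ p.2 ≤ spineRow (2 * n + 2)}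

/-- The separator formed by the spine vertices up to the `n`-th one and the tooth that leads
from the spine to the `n`-th slit. -/
def combCut (n : ℤ) : Set (ℤ × ℤ) :=
  {p | (∃ i, 0 ≤ i ∧ i ≤ n ∧ p = (i + 1, spineRow i)) ∨
    (-1 ≤ p.1 ∧ p.1 ≤ n ∧ p.2 = spineRow n + n + 3)}

/-- The side of `combCut n` that contains the left tails. -/
def leftSide (n : ℤ) : Set (ℤ × ℤ) :=
  {p | p ∈ combRegion ∧ p.2 < spineRow n + n + 3 ∧ (0 ≤ p.1 → spineRow p.1 ≤ p.2)}

theorem leftTail_subset_combRegion {n : ℤ} (hn : 1 ≤ n) (c : ℕ) : leftTail n c ⊆ combRegion :=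
  fun _ hp => mem_combRegion_of_between hn (by have := hp.1; omega) hp.2.1 hp.2.2

theorem rightTail_subset_combRegion {n : ℤ} (hn : 1 ≤ n) (c : ℕ) : rightTail n c ⊆ combRegion := by
  rintro ⟨x, y⟩ ⟨h1, h2, h3⟩
  simp only at h1 h2 h3
  exact mem_combRegion_of_ge (by omega) h2
    (h3.trans (spineRow_le (by omega) (by omega)))

theorem leftTail_subset_leftSide {n : ℤ} (hn : 1 ≤ n) (c : ℕ) : leftTail n c ⊆ leftSide n :=
  fun p hp => ⟨leftTail_subset_combRegion hn c hp, by have := hp.2.2; omega,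
    by have := hp.1; omega⟩

theorem disjoint_rightTail {n : ℤ} (hn : 1 ≤ n) (c : ℕ) :
    Disjoint (rightTail n c) (leftSide n ∪ combCut n) := by
  rw [Set.disjoint_left]
  rintro ⟨x, y⟩ ⟨h1, h2, h3⟩ h
  simp only at h1 h2 h3
  rcases h with ⟨-, -, h⟩ | ⟨i, -, hi, h⟩ | ⟨-, h, -⟩
  · have h4 := spineRow_lt (show 0 ≤ 2 * n + 2 by omega) (show 2 * n + 2 < x by omega)
    simp only at h
    have := h (by omega)
    omega
  · simp only [Prod.mk.injEq] at h
    omega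
  · simp only at h
    omega

/-- There are two ways out of the left side: up into the row of the `n`-th slit, which is present
only from column `-1` on, or to the right over a spine edge. Points of the left side lie in columns
`≤ n`, because further columns of the left half start above that row. -/
theorem leftSide_closed {n : ℤ} (hn : 1 ≤ n) {p q : ℤ × ℤ} (hp : p ∈ leftSide n)
    (hq : q ∈ combRegion) (hpq : squareGrid.Adj p q) : q ∈ leftSide n ∪ combCut n := by
  obtain ⟨x, y⟩ := p
  obtain ⟨z, w⟩ := q
  obtain ⟨hR, hy, hx⟩ := hp
  obtain ⟨hw, hgap, hslit⟩ := mem_combRegion.mp hq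
  obtain ⟨hy0, hgap', -⟩ := mem_combRegion.mp hR
  have hxn : x ≤ n := by
    by_contra h
    have h1 := spineRow_lt (show 0 ≤ n by omega) (show n < x by omega)
    have := hx (by omega)
    simp only at this hy
    omega
  simp only [squareGrid_adj] at hpq hx hy
  by_cases hside : w < spineRow n + n + 3 ∧ (0 ≤ z → spineRow z ≤ w)
  · exact Or.inl ⟨hq, hside⟩
  right
  rcases hpq with ⟨rfl, h | h⟩ | ⟨rfl, h | h⟩
  · right
    have h1 : w = spineRow n + n + 3 := by omega
    refine ⟨?_, hxn, h1⟩
    by_contra h2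
    simp only at h2
    exact hslit ⟨by omega, n, by omega, h1⟩
  · exfalso
    rcases lt_trichotomy x 0 with h0 | rfl | h0
    · omega
    · rw [spineRow_zero] at hside hx
      omega
    · have := spineRow_lt (show 0 ≤ x - 1 by omega) (show x - 1 < x by omega)
      omega
  · left
    rcases lt_trichotomy x (-1) with h0 | rfl | h0
    · omega
    · obtain rfl : z = 0 := by omega
      rw [spineRow_zero] at hside
      omega
    · refine ⟨x, by omega, hxn, ?_⟩
      obtain rfl : z = x + 1 := by omega
      rw [add_sub_cancel_right] at hgap
      have := hx (by omega)
      exact Prod.ext rfl (by simp only; omega)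
  · exfalso
    have : 0 ≤ z → spineRow z ≤ spineRow x := fun h => spineRow_le h (by omega)
    omega

theorem exists_combCut_subset_finset {n : ℤ} (hn : 1 ≤ n) :
    ∃ F : Finset (ℤ × ℤ), combCut n ⊆ F ∧ (F.card : ℤ) ≤ 2 * n + 3 := by
  -- The indices `0, …, n` give the `n + 1` spine vertices, and `n + 1, …, 2 n + 2` give the tooth
  -- columns `-1, …, n`.
  refine ⟨(Finset.Icc 0 (2 * n + 2)).image fun k =>
    if k ≤ n then (k + 1, spineRow k) else (k - n - 2, spineRow n + n + 3), ?_, ?_⟩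
  · rintro ⟨x, y⟩ (⟨i, h0, h1, h⟩ | ⟨h0, h1, h⟩)
    · simp only [Finset.coe_image, Set.mem_image, Finset.mem_coe, Finset.mem_Icc]
      exact ⟨i, by omega, by rw [if_pos h1, h]⟩
    · simp only [Finset.coe_image, Set.mem_image, Finset.mem_coe, Finset.mem_Icc]
      simp only at h0 h1 h
      refine ⟨x + n + 2, by omega, ?_⟩
      rw [if_neg (by omega), h]
      ext <;> simp only; omega
  · have := Finset.card_image_le (s := Finset.Icc 0 (2 * n + 2)) (f := fun k =>
      if k ≤ n then (k + 1, spineRow k) else (k - n - 2, spineRow n + n + 3))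
    rw [Int.card_Icc] at this
    omega

/-! ### Disjoint paths between the tails -/

/-- The union of the part of row `r` left of column `j` and the part of column `j` between the
rows `r` and `s`. -/
def hook (r j s : ℤ) : Set (ℤ × ℤ) :=
  {p | (p.1 ≤ j ∧ p.2 = r) ∨ (p.1 = j ∧ min r s ≤ p.2 ∧ p.2 ≤ max r s)}

/-- The part of row `s` right of column `j`. -/
def rightRay (j s : ℤ) : Set (ℤ × ℤ) :=
  {p | j ≤ p.1 ∧ p.2 = s}

theorem IsClosedOff.hook {R X C : Set (ℤ × ℤ)} (hC : IsClosedOff R X C) {r j s x : ℤ}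
    (h : hook r j s ⊆ R) (hX : Disjoint (hook r j s) X) (hxj : x ≤ j) (hx : (x, r) ∈ C) :
    (j, s) ∈ C := by
  have hRX : ∀ p ∈ _root_.hook r j s, p ∈ R \ X :=
    fun p hp => ⟨h hp, Set.disjoint_left.mp hX hp⟩
  refine hC.column (fun y h1 h2 => hRX _ (Or.inr ⟨rfl, h1, h2⟩)) (y₀ := r) ?_
  exact hC.row (fun z h1 h2 => hRX _ (Or.inl ⟨by simp only; omega, rfl⟩)) hx

theorem IsClosedOff.rightRay {R X C : Set (ℤ × ℤ)} (hC : IsClosedOff R X C) {j s x y : ℤ}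
    (h : rightRay j s ⊆ R) (hX : Disjoint (rightRay j s) X) (hy : j ≤ y) (hx : j ≤ x)
    (hxC : (x, s) ∈ C) : (y, s) ∈ C :=
  hC.row (fun z _ _ => ⟨h ⟨by simp only; omega, rfl⟩,
    Set.disjoint_left.mp hX ⟨by simp only; omega, rfl⟩⟩) hxC

/-- A two-way infinite path that consists of a left ray in row `r`, a part of column `j` and a
right ray in row `s`. -/
def zPath (r j s : ℤ) : Set (ℤ × ℤ) := hook r j s ∪ rightRay j s

theorem mem_zPath {r j s x y : ℤ} : (x, y) ∈ zPath r j s ↔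
    ((x ≤ j ∧ y = r) ∨ (x = j ∧ min r s ≤ y ∧ y ≤ max r s)) ∨ (j ≤ x ∧ y = s) := Iff.rfl

theorem exists_mem_zPath {R X C D : Set (ℤ × ℤ)} (hC : IsClosedOff R X C) (hCD : Disjoint C D)
    {r j s x y : ℤ} (h : zPath r j s ⊆ R) (hx : x ≤ j) (hxC : (x, r) ∈ C) (hy : j ≤ y)
    (hyD : (y, s) ∈ D) : ∃ p ∈ X, p ∈ zPath r j s := by
  by_contra hcon
  push Not at hcon
  have hX : Disjoint (zPath r j s) X := Set.disjoint_right.mpr hcon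
  refine Set.disjoint_left.mp hCD ?_ hyD
  exact hC.rightRay (Set.subset_union_right.trans h) (hX.mono_left Set.subset_union_right) hy
    le_rfl (hC.hook (Set.subset_union_left.trans h) (hX.mono_left Set.subset_union_left) hx hxC)

/-- The path through the `i`-th spine vertex that turns upwards to the left tail. -/
def spinePath (n i : ℤ) : Set (ℤ × ℤ) := zPath (spineRow n - n + i) i (spineRow i)

/-- The path through the vertex in column `j` of the `n`-th tooth. -/
def toothPath (n j : ℤ) : Set (ℤ × ℤ) :=
  zPath (spineRow n + 1 + n - j) j (spineRow (2 * n + 1 - j))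

theorem spinePath_subset {n i : ℤ} (hn : 1 ≤ n) (hi : 0 ≤ i) (hin : i ≤ n) :
    spinePath n i ⊆ combRegion := by
  have h0 := spineRow_le le_rfl hi
  rw [spineRow_zero] at h0
  have h1 : spineRow i ≤ spineRow n - n + i := by
    rcases hin.eq_or_lt with rfl | h
    · omega
    · have := spineRow_lt hi h
      omega
  rintro ⟨x, y⟩ h
  rw [spinePath, mem_zPath] at h
  rcases h with (⟨h2, rfl⟩ | ⟨rfl, h2, h3⟩) | ⟨h2, rfl⟩
  · by_cases hx : x ≤ 0
    · exact mem_combRegion_of_between hn hx (by omega) (by omega)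
    · have := spineRow_le (show 0 ≤ x by omega) h2
      exact mem_combRegion_of_le (by omega) (by omega) (by omega)
  · exact mem_combRegion_of_le (by omega) (by omega) (by omega)
  · exact spineRow_mem_combRegion hi (by omega)

theorem toothPath_subset {n j : ℤ} (hn : 1 ≤ n) (hj : -1 ≤ j) (hjn : j ≤ n) :
    toothPath n j ⊆ combRegion := by
  have h0 := spineRow_le le_rfl (show 0 ≤ n by omega)
  rw [spineRow_zero] at h0
  have h1 : ∀ x, 0 ≤ x → x ≤ n → spineRow x ≤ spineRow n := fun x hx h => spineRow_le hx h
  have h4 := spineRow_lt (show 0 ≤ n by omega) (show n < 2 * n + 1 - j by omega)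
  rintro ⟨x, y⟩ h
  rw [toothPath, mem_zPath] at h
  rcases h with (⟨h2, rfl⟩ | ⟨rfl, h2, h3⟩) | ⟨h2, rfl⟩
  · by_cases hx : x ≤ 0
    · exact mem_combRegion_of_between hn hx (by omega) (by omega)
    · have := h1 x (by omega) (by omega)
      exact mem_combRegion_of_le (by omega) (by omega) (by omega)
  · refine mem_combRegion_of_le (by omega) (by omega) fun hx => ?_
    have := h1 x (by omega) hjn
    omega
  · exact spineRow_mem_combRegion (by omega) (by omega)

/-- A second connection between the first spine vertex and the left tail. -/
def outerHook (n : ℤ) : Set (ℤ × ℤ) := hook (spineRow n - n - 1) (-1) 0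

theorem outerHook_subset {n : ℤ} (hn : 1 ≤ n) : outerHook n ⊆ combRegion := by
  have h1 := spineRow_lt le_rfl (show 0 < n by omega)
  rw [spineRow_zero] at h1
  rintro ⟨x, y⟩ (⟨h2, h3⟩ | ⟨h2, h3, h4⟩)
  · simp only at h2 h3
    exact mem_combRegion_of_between hn (by omega) (by omega) (by omega)
  · simp only at h2 h3 h4
    exact mem_combRegion_of_le (by omega) (by omega) (by omega)

/-- The union of two disjoint connections from the left tail to the first spine vertex with two
disjoint connections from there to the right tail. -/
def doublePath (n : ℤ) : Set (ℤ × ℤ) := spinePath n 0 ∪ outerHook n ∪ rightRay 2 1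

theorem rightRay_two_one_subset : rightRay 2 1 ⊆ combRegion := by
  rintro ⟨x, y⟩ ⟨h1, h2⟩
  simp only at h1 h2
  subst h2
  have := spineRow_lt le_rfl (show 0 < x - 1 by omega)
  rw [spineRow_zero] at this
  exact mem_combRegion_of_ge (by omega) (by omega) (by omega)

/-- The paths are nested: that of the larger column starts in a lower row, turns further right and
ends in a lower spine row. -/
theorem toothPath_disjoint {n i j : ℤ} (hn : 1 ≤ n) (hj : -1 ≤ i) (hij : i < j) (hjn : j ≤ n)
    {p : ℤ × ℤ} (h1 : p ∈ toothPath n i) (h2 : p ∈ toothPath n j) : False := by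
  obtain ⟨x, y⟩ := p
  rw [toothPath, mem_zPath] at h1 h2
  have h3 := spineRow_lt (show 0 ≤ n by omega) (show n < 2 * n + 1 - j by omega)
  have h4 := spineRow_lt (show 0 ≤ 2 * n + 1 - j by omega)
    (show 2 * n + 1 - j < 2 * n + 1 - i by omega)
  omega

/-- Here the path of the larger index lies above the other one throughout. -/
theorem spinePath_disjoint {n i j : ℤ} (hi : 0 ≤ i) (hij : i < j) (hjn : j ≤ n)
    {p : ℤ × ℤ} (h1 : p ∈ spinePath n i) (h2 : p ∈ spinePath n j) : False := by
  obtain ⟨x, y⟩ := p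
  rw [spinePath, mem_zPath] at h1 h2
  have h3 := spineRow_lt hi hij
  have h4 : spineRow j ≤ spineRow n - n + j := by
    rcases hjn.eq_or_lt with rfl | h
    · omega
    · have := spineRow_lt (by omega) h
      omega
  omega

theorem le_of_mem_spinePath {n i : ℤ} (hi : 0 ≤ i) (hin : i ≤ n) {p : ℤ × ℤ}
    (h : p ∈ spinePath n i) : spineRow i ≤ p.2 ∧ p.2 ≤ spineRow n := by
  obtain ⟨x, y⟩ := p
  rw [spinePath, mem_zPath] at h
  simp only
  rcases hin.eq_or_lt with rfl | h'
  · omega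
  · have := spineRow_lt (by omega) h'
    omega

theorem lt_of_mem_toothPath {n j : ℤ} (hn : 1 ≤ n) (hjn : j ≤ n) {p : ℤ × ℤ}
    (h : p ∈ toothPath n j) : spineRow n < p.2 := by
  obtain ⟨x, y⟩ := p
  rw [toothPath, mem_zPath] at h
  have h3 := spineRow_lt (show 0 ≤ n by omega) (show n < 2 * n + 1 - j by omega)
  simp only
  omega

theorem le_of_mem_doublePath {n : ℤ} (hn : 1 ≤ n) {p : ℤ × ℤ} (h : p ∈ doublePath n) :
    p.2 ≤ spineRow n := by
  have h1 := spineRow_lt le_rfl (show 0 < n by omega)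
  rw [spineRow_zero] at h1
  rcases h with (h | h | h) | h
  · exact (le_of_mem_spinePath le_rfl (by omega) h).2
  · omega
  · omega
  · have := h.2
    omega

theorem doublePath_disjoint {n i : ℤ} (hn : 1 ≤ n) (hi : 1 ≤ i) (hin : i ≤ n) {p : ℤ × ℤ}
    (h1 : p ∈ doublePath n) (h2 : p ∈ spinePath n i) : False := by
  have h0 := spineRow_lt le_rfl (show 0 < i by omega)
  rw [spineRow_zero] at h0
  have h3 := le_of_mem_spinePath (by omega) hin h2
  rcases h1 with (h1 | h1) | h1
  · exact spinePath_disjoint le_rfl (by omega) hin h1 h2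
  · obtain ⟨x, y⟩ := p
    rw [spinePath, mem_zPath] at h2
    simp only [outerHook, hook, Set.mem_ofPred_eq] at h1 h3
    have h4 := spineRow_lt le_rfl (show 0 < n by omega)
    rw [spineRow_zero] at h4
    omega
  · have := h1.2
    omega

/-- A system of `2 n + 3` disjoint connections between the left and the right tail. -/
def pathSystem (n k : ℤ) : Set (ℤ × ℤ) :=
  -- Indexed as the cut is. The doubled path counts as a single member of the system.
  if k = 0 then doublePath n else if k ≤ n then spinePath n k else toothPath n (k - n - 2)

theorem pathSystem_disjoint {n k l : ℤ} (hn : 1 ≤ n) (hk : 0 ≤ k) (hkl : k < l)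
    (hl : l ≤ 2 * n + 2) {p : ℤ × ℤ} (h1 : p ∈ pathSystem n k) (h2 : p ∈ pathSystem n l) :
    False := by
  unfold pathSystem at h1 h2
  rw [if_neg (by omega)] at h2
  split_ifs at h1 h2 with h3 h4 h5 h6
  · exact doublePath_disjoint hn (by omega) h4 h1 h2
  · have := le_of_mem_doublePath hn h1
    have := lt_of_mem_toothPath hn (by omega) h2
    omega
  · exact spinePath_disjoint hk hkl (by omega) h1 h2
  · have := (le_of_mem_spinePath hk h5 h1).2
    have := lt_of_mem_toothPath hn (by omega) h2
    omega
  · omega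
  · exact toothPath_disjoint hn (by omega) (by omega) (by omega) h1 h2

/-! ### Small separators pass through the bottleneck -/

/-- A set that meets each of at least as many pairwise disjoint sets as it has elements meets
each of them exactly once. -/
theorem Finset.card_eq_and_unique_of_hits {α κ : Type*} [Nonempty α] {X : Finset α} {I : Finset κ}
    {S : κ → Set α} (hS : ∀ k ∈ I, ∀ l ∈ I, ∀ p, p ∈ S k → p ∈ S l → k = l)
    (hit : ∀ k ∈ I, ∃ p ∈ X, p ∈ S k) (hcard : X.card ≤ I.card) :
    X.card = I.card ∧ ∀ k ∈ I, ∀ p ∈ X, ∀ q ∈ X, p ∈ S k → q ∈ S k → p = q := by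
  choose! f hfX hfS using hit
  have hinj : Set.InjOn f I := fun k hk l hl hkl =>
    hS k hk l hl (f k) (hfS k hk) (hkl ▸ hfS l hl)
  have heq : X.card = I.card := le_antisymm hcard
    (Finset.card_le_card_of_injOn f hfX hinj)
  have hsurj := Finset.surjOn_of_injOn_of_card_le f hfX hinj hcard
  have key : ∀ k ∈ I, ∀ p ∈ X, p ∈ S k → p = f k := by
    intro k hk p hp hpk
    obtain ⟨l, hl, rfl⟩ := hsurj hp
    rw [hS k hk l hl _ hpk (hfS l hl)]
  exact ⟨heq, fun k hk p hp q hq hpk hqk => (key k hk p hp hpk).trans (key k hk q hq hqk).symm⟩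

/-- A separator of size at most `2 n + 3` between the left and the right tail meets the double
path only in the bottleneck next to the first spine vertex. -/
theorem separates_bottleneck {n : ℤ} (hn : 1 ≤ n) {X : Finset (ℤ × ℤ)} {C D : Set (ℤ × ℤ)}
    (hcard : (X.card : ℤ) ≤ 2 * n + 3) (hC : IsClosedOff combRegion X C)
    (hD : IsClosedOff combRegion X D) (hCD : Disjoint C D) {c d : ℕ} (hc : leftTail n c ⊆ C)
    (hd : rightTail n d ⊆ D) :
    (X.card : ℤ) = 2 * n + 3 ∧ (-1, 0) ∈ C ∧ (3, 0) ∈ D := by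
  have hn0 := spineRow_lt le_rfl (show 0 < n by omega)
  rw [spineRow_zero] at hn0
  have hn2 := spineRow_lt (show 0 ≤ n by omega) (show n < 2 * n + 2 by omega)
  have hl : ∀ r, spineRow n - n - 1 ≤ r → r ≤ spineRow n + n + 2 → (-2 - (c : ℤ), r) ∈ C :=
    fun r h1 h2 => hc ⟨le_rfl, h1, h2⟩
  have hr : ∀ s, 0 ≤ s → s ≤ spineRow (2 * n + 2) → (2 * n + 4 + (d : ℤ), s) ∈ D :=
    fun s h1 h2 => hd ⟨le_rfl, h1, h2⟩
  have hspine : ∀ i, 0 ≤ i → i ≤ n → ∃ p ∈ X, p ∈ spinePath n i := by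
    intro i h1 h2
    have h3 := spineRow_le le_rfl h1
    rw [spineRow_zero] at h3
    exact exists_mem_zPath hC hCD (spinePath_subset hn h1 h2) (x := -2 - c) (by omega)
      (hl _ (by omega) (by omega)) (y := 2 * n + 4 + d) (by omega)
      (hr _ h3 (spineRow_le h1 (by omega)))
  have htooth : ∀ j, -1 ≤ j → j ≤ n → ∃ p ∈ X, p ∈ toothPath n j := by
    intro j h1 h2
    have h3 := spineRow_le le_rfl (show 0 ≤ 2 * n + 1 - j by omega)
    rw [spineRow_zero] at h3
    exact exists_mem_zPath hC hCD (toothPath_subset hn h1 h2) (x := -2 - c) (by omega)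
      (hl _ (by omega) (by omega)) (y := 2 * n + 4 + d) (by omega)
      (hr _ h3 (spineRow_le (by omega) (by omega)))
  obtain ⟨hX, huniq⟩ := Finset.card_eq_and_unique_of_hits (X := X)
    (I := Finset.Icc 0 (2 * n + 2)) (S := pathSystem n)
    (by
      intro k hk l hl p hpk hpl
      rw [Finset.mem_Icc] at hk hl
      rcases lt_trichotomy k l with h | h | h
      · exact (pathSystem_disjoint hn hk.1 h hl.2 hpk hpl).elim
      · exact h
      · exact (pathSystem_disjoint hn hl.1 h hk.2 hpl hpk).elim)
    (by
      intro k hk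
      rw [Finset.mem_Icc] at hk
      unfold pathSystem
      split_ifs with h1 h2
      · obtain ⟨p, hp, hpS⟩ := hspine 0 le_rfl (by omega)
        exact ⟨p, hp, Or.inl (Or.inl hpS)⟩
      · exact hspine k hk.1 h2
      · exact htooth _ (by omega) (by omega))
    (by
      rw [Int.card_Icc]
      omega)
  rw [Int.card_Icc] at hX
  have huniq' : ∀ p ∈ X, ∀ q ∈ X, p ∈ doublePath n → q ∈ doublePath n → p = q := by
    have := huniq 0 (by rw [Finset.mem_Icc]; omega)
    simpa [pathSystem] using this
  have hspine0 : spinePath n 0 = hook (spineRow n - n) 0 0 ∪ rightRay 0 0 := by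
    simp [spinePath, zPath, spineRow_zero]
  have hsub0 := spinePath_subset hn le_rfl (show 0 ≤ n by omega)
  have hdouble : doublePath n =
      hook (spineRow n - n) 0 0 ∪ rightRay 0 0 ∪ outerHook n ∪ rightRay 2 1 := by
    rw [doublePath, hspine0]
  rw [hspine0] at hsub0
  obtain ⟨hsub1, hsub2⟩ := Set.union_subset_iff.mp hsub0
  have hmem : ∀ {S T : Set (ℤ × ℤ)}, S ⊆ doublePath n → T ⊆ doublePath n → Disjoint S T →
      Disjoint S X ∨ Disjoint T X := by
    intro S T hS hT hST
    by_contra! h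
    rw [Set.not_disjoint_iff, Set.not_disjoint_iff] at h
    obtain ⟨⟨p, hpS, hpX⟩, q, hqT, hqX⟩ := h
    have := huniq' p hpX q hqX (hS hpS) (hT hqT)
    exact Set.disjoint_left.mp hST hpS (this ▸ hqT)
  have hS1 : hook (spineRow n - n) 0 0 ⊆ doublePath n := by
    rw [hdouble]; exact fun p hp => Or.inl (Or.inl (Or.inl hp))
  have hS2 : rightRay 0 0 ⊆ doublePath n := by
    rw [hdouble]; exact fun p hp => Or.inl (Or.inl (Or.inr hp))
  have hS3 : outerHook n ⊆ doublePath n := by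
    rw [hdouble]; exact fun p hp => Or.inl (Or.inr hp)
  have hS4 : rightRay 2 1 ⊆ doublePath n := by
    rw [hdouble]; exact fun p hp => Or.inr hp
  have hfar : (2 * n + 4 + (d : ℤ), 0) ∈ D := hr 0 le_rfl (by omega)
  have hfar1 : (2 * n + 4 + (d : ℤ), 1) ∈ D := hr 1 (by omega) (by omega)
  refine ⟨by omega, ?_, ?_⟩
  -- The single vertex of `X` on the double path misses either the outer hook, which then joins the
  -- left tail to `(-1, 0)`, or the whole path `spinePath n 0`, which would join the two tails.
  · rcases hmem hS3 (Set.union_subset hS1 hS2) (by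
      rw [Set.disjoint_left]
      rintro ⟨x, y⟩ h1 h2
      simp only [outerHook, hook, rightRay, Set.mem_union, Set.mem_ofPred_eq] at h1 h2
      omega) with h | h
    · exact hC.hook (outerHook_subset hn) h (by omega) (hl _ le_rfl (by omega))
    · rw [Set.disjoint_union_left] at h
      exact (Set.disjoint_left.mp hCD (hC.rightRay hsub2 h.2 (by omega) le_rfl
        (hC.hook hsub1 h.1 (by omega) (hl _ (by omega) (by omega)))) hfar).elim
  · have hS5 : rightRay 3 0 ⊆ rightRay 0 0 := fun p hp =>
      ⟨le_trans (by omega) hp.1, hp.2⟩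
    -- If `X` meets row `0` from column `3` on, it avoids the detour through `(0, 0)`, `(2, 0)` and
    -- row `1`, which then joins the tails.
    rcases hmem (hS5.trans hS2) (T := hook (spineRow n - n) 0 0 ∪ {p | 0 ≤ p.1 ∧ p.1 ≤ 2 ∧ p.2 = 0}
        ∪ rightRay 2 1)
        (Set.union_subset (Set.union_subset hS1 fun p hp => hS2 ⟨hp.1, hp.2.2⟩) hS4) (by
      rw [Set.disjoint_left]
      rintro ⟨x, y⟩ h1 h2
      simp only [hook, rightRay, Set.mem_union, Set.mem_ofPred_eq] at h1 h2
      omega) with h | h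
    · exact hD.rightRay (hS5.trans hsub2) h le_rfl (by omega) hfar
    · rw [Set.disjoint_union_left, Set.disjoint_union_left] at h
      obtain ⟨⟨h1, h2⟩, h3⟩ := h
      have e1 : ((0, 0) : ℤ × ℤ) ∈ C :=
        hC.hook hsub1 h1 (by omega) (hl _ (by omega) (by omega))
      have e2 : ((2, 0) : ℤ × ℤ) ∈ C := by
        refine hC.row (fun z h4 h5 => ⟨hsub2 ⟨by simp only; omega, rfl⟩,
          Set.disjoint_left.mp h2 ⟨by simp only; omega, by simp only; omega, rfl⟩⟩) e1
      have e3 : ((2, 1) : ℤ × ℤ) ∈ C := hC _ e2 _ (rightRay_two_one_subset ⟨le_rfl, rfl⟩)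
        (Set.disjoint_left.mp h3 ⟨le_rfl, rfl⟩) (by simp [squareGrid_adj])
      exact (Set.disjoint_left.mp hCD
        (hC.rightRay rightRay_two_one_subset h3 (by omega) le_rfl e3) hfar1).elim

theorem exists_disjoint_tail {W : Set combRegion} (hW : W.Finite) (n : ℤ) (hn : 1 ≤ n) :
    ∃ c : ℕ, Disjoint (Subtype.val ⁻¹' leftTail n c) W ∧
      Disjoint (Subtype.val ⁻¹' rightTail n c) W := by
  obtain ⟨c, hc⟩ := (hW.image fun x => x.1.1.natAbs).bddAbove
  have hb : ∀ x ∈ W, x.1.1.natAbs ≤ c := fun x hx => hc ⟨x, hx, rfl⟩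
  refine ⟨c, ?_, ?_⟩
  · rw [Set.disjoint_left]
    intro x hx hxW
    have h1 := hx.1
    have h2 := hb x hxW
    omega
  · rw [Set.disjoint_left]
    intro x hx hxW
    have h1 := hx.1
    have h2 := hb x hxW
    omega

/-! ### The contradiction -/

/-- In a rooted tree-decomposition with all the desired properties there is, for every `n ≥ 1`,
an edge with adhesion set of size `2 n + 3` whose part strictly above contains one of two fixed
vertices. -/
theorem exists_edge_card_adhesion {ι : Type v} {D : RootedTreeDecomp combGraph ι}
    (hf : D.FiniteParts) (ht : D.Tight) (hc : D.Componental) (hs : D.StronglyLinked) {n : ℤ}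
    (hn : 1 ≤ n) :
    ∃ e ∈ D.tree.edgeSet, ((D.adhesion e).ncard : ℤ) = 2 * n + 3 ∧
      ((-1, 0) ∈ Subtype.val '' D.strictlyAbove e ∨ (3, 0) ∈ Subtype.val '' D.strictlyAbove e) := by
  classical
  obtain ⟨F, hF, hFcard⟩ := exists_combCut_subset_finset hn
  have hcut : (Subtype.val ⁻¹' combCut n : Set combRegion).Finite :=
    (F.finite_toSet.subset hF).preimage Subtype.val_injective.injOn
  have hside : ∀ x : combRegion, x.1 ∈ leftSide n → ∀ y : combRegion, combGraph.Adj x y →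
      y.1 ∈ leftSide n ∪ combCut n := fun x hx y hxy => leftSide_closed hn hx y.2 hxy
  obtain ⟨e, he, hcard, c, d, hcd⟩ := RootedTreeDecomp.exists_edge_separating hf
    (isLocallyFiniteGraph_induce_squareGrid _) ht hc hs combGraph_connected hcut
    (P := Subtype.val ⁻¹' leftSide n) (Q := Subtype.val ⁻¹' (leftSide n ∪ combCut n)ᶜ)
    (by
      rw [Set.disjoint_left]
      exact fun x hx h => h (Or.inl hx))
    hside
    (by
      intro x hx y hxy
      by_cases hy : y.1 ∈ combCut n
      · exact Or.inr hy
      · exact Or.inl fun h => hx (hside y (h.resolve_right hy) x hxy.symm))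
    (K := fun c => Subtype.val ⁻¹' leftTail n c) (L := fun c => Subtype.val ⁻¹' rightTail n c)
    (fun c => ⟨⟨⟨(-2 - c, spineRow n), leftTail_subset_combRegion hn c
        ⟨le_rfl, by simp only; omega, by simp only; omega⟩⟩,
        le_rfl, by simp only; omega, by simp only; omega⟩,
      isLinkedSet_preimage_of_box (fun p hp q hq r h1 h2 h3 h4 => by
        obtain ⟨p1, p2, p3⟩ := hp
        obtain ⟨q1, q2, q3⟩ := hq
        exact ⟨by omega, by omega, by omega⟩) (leftTail_subset_combRegion hn c),
      Set.preimage_mono (leftTail_subset_leftSide hn c)⟩)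
    (fun c => by
      have h0 := spineRow_le le_rfl (show 0 ≤ 2 * n + 2 by omega)
      rw [spineRow_zero] at h0
      exact ⟨⟨⟨(2 * n + 4 + c, 0), rightTail_subset_combRegion hn c
        ⟨le_rfl, le_rfl, h0⟩⟩, le_rfl, le_rfl, h0⟩,
      isLinkedSet_preimage_of_box (fun p hp q hq r h1 h2 h3 h4 => by
        obtain ⟨p1, p2, p3⟩ := hp
        obtain ⟨q1, q2, q3⟩ := hq
        exact ⟨by omega, by omega, by omega⟩) (rightTail_subset_combRegion hn c),
      fun x hx h => Set.disjoint_left.mp (disjoint_rightTail hn c) hx h⟩)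
    (fun W hW => (exists_disjoint_tail hW n hn).imp fun c h => h.1)
    (fun W hW => (exists_disjoint_tail hW n hn).imp fun c h => h.2)
  have hfin := D.finite_adhesion hf e
  let X : Finset (ℤ × ℤ) := hfin.toFinset.image Subtype.val
  have hXcoe : (X : Set (ℤ × ℤ)) = Subtype.val '' D.adhesion e := by simp [X]
  have hXcard : X.card = (D.adhesion e).ncard := by
    rw [Finset.card_image_of_injective _ Subtype.val_injective, Set.ncard_eq_toFinset_card _ hfin]
  have hXle : (X.card : ℤ) ≤ 2 * n + 3 := by
    rw [← Set.cast_ncard hfin, ← Set.cast_ncard hcut, Nat.cast_le] at hcard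
    have h2 : (Subtype.val ⁻¹' combCut n : Set combRegion).ncard ≤ F.card := by
      rw [← Set.ncard_coe_finset]
      exact Set.ncard_le_ncard_of_injOn Subtype.val (fun x hx => hF hx)
        Subtype.val_injective.injOn F.finite_toSet
    omega
  have hnb := RootedTreeDecomp.setNeighbourhood_strictlyAbove ht hc he
  -- Since `V_e` is the neighbourhood of the part strictly above `e`, both this part and the rest
  -- outside `V_e` are closed off `X`. Either may play the role of the left side.
  have hclosed : IsClosedOff combRegion X (Subtype.val '' D.strictlyAbove e) := by
    rw [hXcoe]
    rintro _ ⟨p, hp, rfl⟩ q hq hqX hpq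
    by_contra hqe
    refine hqX ⟨⟨q, hq⟩, ?_, rfl⟩
    rw [← hnb]
    exact ⟨fun h => hqe ⟨_, h, rfl⟩, p, hp, hpq⟩
  have hclosed' : IsClosedOff combRegion X
      (Subtype.val '' (D.strictlyAbove e ∪ D.adhesion e)ᶜ) := by
    rw [hXcoe]
    rintro _ ⟨p, hp, rfl⟩ q hq hqX hpq
    refine ⟨⟨q, hq⟩, ?_, rfl⟩
    rintro (h | h)
    · refine hp (Or.inr ?_)
      rw [← hnb]
      exact ⟨fun h' => hp (Or.inl h'), ⟨q, hq⟩, h, SimpleGraph.Adj.symm hpq⟩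
    · exact hqX ⟨_, h, rfl⟩
  have hdisj : Disjoint (Subtype.val '' D.strictlyAbove e)
      (Subtype.val '' (D.strictlyAbove e ∪ D.adhesion e)ᶜ) := by
    rw [Set.disjoint_image_iff Subtype.val_injective, Set.disjoint_left]
    exact fun x hx h => h (Or.inl hx)
  have hin : ∀ {K : Set (ℤ × ℤ)} {S : Set combRegion}, K ⊆ combRegion →
      Subtype.val ⁻¹' K ⊆ S → K ⊆ Subtype.val '' S :=
    fun hK hKS p hp => ⟨⟨p, hK hp⟩, hKS hp, rfl⟩
  have hleft := leftTail_subset_combRegion hn c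
  have hright := rightTail_subset_combRegion hn d
  refine ⟨e, he, ?_⟩
  rw [← hXcard]
  rcases hcd with ⟨h1, h2⟩ | ⟨h1, h2⟩
  · obtain ⟨h3, h4, -⟩ := separates_bottleneck hn hXle hclosed hclosed' hdisj
      (hin hleft h1) (hin hright (Set.subset_compl_iff_disjoint_right.mpr h2))
    exact ⟨h3, Or.inl h4⟩
  · obtain ⟨h3, -, h4⟩ := separates_bottleneck hn hXle hclosed' hclosed hdisj.symm
      (hin hleft (Set.subset_compl_iff_disjoint_right.mpr h2)) (hin hright h1)
    exact ⟨h3, Or.inr h4⟩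

theorem finite_setOf_coe_mem_strictlyAbove {ι : Type v} (D : RootedTreeDecomp combGraph ι)
    (p : ℤ × ℤ) : {e ∈ D.tree.edgeSet | p ∈ Subtype.val '' D.strictlyAbove e}.Finite := by
  by_cases hp : p ∈ combRegion
  · refine (RootedTreeDecomp.finite_setOf_mem_strictlyAbove (D := D) ⟨p, hp⟩).subset ?_
    rintro e ⟨he, x, hx, rfl⟩
    exact ⟨he, hx⟩
  · refine Set.finite_empty.subset ?_
    rintro e ⟨-, x, -, rfl⟩
    exact hp x.2

theorem mainTheorem2 :
    ∃ (V : Type) (G : SimpleGraph V),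
      IsPlanarGraph G ∧ IsLocallyFiniteGraph G ∧ G.Connected ∧
      (∃ (ι : Type) (D : TreeDecomp G ι), D.FiniteParts) ∧
      ¬ ∃ (ι : Type u) (D : RootedTreeDecomp G ι),
          D.FiniteParts ∧ D.Tight ∧ D.Componental ∧ D.StronglyLinked := by
  refine ⟨combRegion, combGraph, isPlanarGraph_induce_squareGrid _,
    isLocallyFiniteGraph_induce_squareGrid _, combGraph_connected,
    ⟨ℕ, exists_treeDecomp_induce_squareGrid _⟩, ?_⟩
  rintro ⟨ι, D, hf, ht, hc, hs⟩
  have key := fun m : ℕ =>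
    exists_edge_card_adhesion hf ht hc hs (show (1 : ℤ) ≤ m + 1 by omega)
  choose e he hcard hmem using key
  -- The adhesion sizes `2 (m + 1) + 3` make the edges distinct, so infinitely many edges have one
  -- of the two vertices strictly above them.
  refine Set.infinite_of_injective_forall_mem (f := e) (fun a b hab => ?_) (fun m => ?_)
    ((finite_setOf_coe_mem_strictlyAbove D (-1, 0)).union
      (finite_setOf_coe_mem_strictlyAbove D (3, 0)))
  · have h1 := hcard a
    have h2 := hcard b
    rw [hab] at h1
    omega
  · exact (hmem m).imp (⟨he m, ·⟩) (⟨he m, ·⟩)
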